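/- Write $\mathbb D=\{z\in\mathbb C:|z|<1\}$, and for $|\rho|=1$ let $P_\rho(z)=\mathrm{Re}\,\frac{1+z/\rho}{1-z/\rho}$ on $\mathbb D$. On a probability space let $B_{\mathbb C}$ be a standard complex Brownian motion (independent standard real Brownian motions as real and imaginary parts, started at $0$) and let $B$ be a standard real Brownian motion independent of $B_{\mathbb C}$. Let $\delta$ be the maximal solution, with lifetime $\tau_1$, of $\delta'(t)=\frac{(\partial_x+i\partial_y)P_1}{P_1}(\delta(t)+B_{\mathbb C}(t))$, $\delta(0)=0$, with $\delta+B_{\mathbb C}\in\mathbb D$, and let $B^1_{\mathbb C}(t)=B_{\mathbb C}(t)+\delta(t)$, $0\le t<\tau_1$. Let $\xi(t)=\sqrt2\,B(t)$. Let $g_t$ be the radial Loewner maps $\partial_t g_t(z)=g_t(z)\frac{e^{i\xi(t)}+g_t(z)}{e^{i\xi(t)}-g_t(z)}$, $g_0(z)=z$, where the domain $D_t$ of $g_t$ is the set of $z\in\mathbb D$ for which the solution exists on $[0,t]$. Let $\beta$ be the standard radial SLE$_2$ curve driven by $\xi$, that is, almost surely $\beta$ is continuous on $[0,\infty)$ and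 $\beta(t)=\lim_{\mathbb D\ni z\to e^{i\xi(t)}}g_t^{-1}(z)$ for all $t\ge0$. Put $Q_t=P_{e^{i\xi(t)}}\circ g_t$ on $D_t$, let $\mathcal D$ be the set of $(t_1,t_2)\in[0,\tau_1)\times[0,\infty)$ with $B^1_{\mathbb C}[0,t_1]\cap\beta[0,t_2]=\emptyset$, and on $\mathcal D$ put $$M(t_1,t_2)=\frac{Q_{t_2}(B^1_{\mathbb C}(t_1))}{Q_0(B^1_{\mathbb C}(t_1))}.$$ Let $\sigma_1,\sigma_2\subset\mathbb D\setminus\{0\}$ be disjoint Jordan curves, each surrounding $0$, such that $\sigma_2$ surrounds $\sigma_1$. Let $T^1_{\sigma_1}$ be the first time that $B^1_{\mathbb C}$ hits $\sigma_1$ and $T^2_{\sigma_2}$ the first time that $\beta$ hits $\sigma_2$ (with value $\infty$ if there is no such time). Then there is a constant $C$, depending only on $\sigma_1$ and $\sigma_2$, such that almost surely, for all finite times $t_1\in[0,T^1_{\sigma_1}]$ and $t_2\in[0,T^2_{\sigma_2}]$: $(t_1,t_2)\in\mathcal D$, $B^1_{\mathbb C}(t_1)\in D_{t_2}$, $M(t_1,t_2)>0$,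 and $$|\ln M(t_1,t_2)|\le C.$$ -/

import Mathlib

namespace LoopErasure

open MeasureTheory ProbabilityTheory Set Filter Topology
open scoped NNReal ENNReal

noncomputable section

/-! ### Jordan curves -/

/-- A Jordan curve: the image of a continuous injective map of the circle into the plane. -/
def IsJordanCurve (σ : Set ℂ) : Prop :=
  ∃ γ : Circle → ℂ, Continuous γ ∧ Function.Injective γ ∧ range γ = σ

/-- `σ` surrounds the point `z`: `z` is off `σ` and lies in a bounded component of its
complement. -/
def Surrounds (σ : Set ℂ) (z : ℂ) : Prop :=
  z ∉ σ ∧ Bornology.IsBounded (connectedComponentIn σᶜ z)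

/-- The Jordan curves in `𝔻 ∖ {0}` that surround `0`. -/
def JordanClass : Set (Set ℂ) :=
  {σ | IsJordanCurve σ ∧ σ ⊆ Metric.ball (0 : ℂ) 1 \ {0} ∧ Surrounds σ 0}

/-- The pairs `(σ₁, σ₂)` of disjoint curves of this class such that `σ₂` surrounds `σ₁`. -/
def JordanPairs : Set (Set ℂ × Set ℂ) :=
  {p | p.1 ∈ JordanClass ∧ p.2 ∈ JordanClass ∧ Disjoint p.1 p.2 ∧ ∀ z ∈ p.1, Surrounds p.2 z}

/-! ### Poisson kernels -/

/-- The normalized Poisson kernel `P_ρ(z) = P(z / ρ)`, `P(z) = Re ((1 + z) / (1 - z))`, in the unit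
disc with pole at the point `ρ` of the unit circle. -/
def diskPoisson (ρ z : ℂ) : ℝ := ((1 + z / ρ) / (1 - z / ρ)).re

/-- The operator `2 ∂_{z̄} = ∂_x + i ∂_y` on real-valued functions. -/
def twoDbar (f : ℂ → ℝ) (z : ℂ) : ℂ :=
  (fderiv ℝ f z 1 : ℂ) + Complex.I * (fderiv ℝ f z Complex.I : ℂ)

/-! ### The conditioned complex Brownian path

Deterministic constructions from a path `b`, to be applied to a path of complex Brownian motion. -/

/-- `δ` solves `δ' = (2 ∂_{z̄} P_ρ / P_ρ)(δ + b)`, `δ(0) = 0`, on `[0, T]`, with `δ + b` in the unit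
disc. -/
def IsDriftSolution (ρ : ℂ) (b : ℝ≥0 → ℂ) (T : ℝ≥0) (δ : ℝ → ℂ) : Prop :=
  δ 0 = 0 ∧ ∀ t ∈ Icc (0 : ℝ) T,
    δ t + b t.toNNReal ∈ Metric.ball (0 : ℂ) 1 ∧
    HasDerivWithinAt δ
      (twoDbar (diskPoisson ρ) (δ t + b t.toNNReal) / (diskPoisson ρ (δ t + b t.toNNReal) : ℂ))
      (Icc (0 : ℝ) T) t

/-- The lifetime `τ_ρ`: the solution exists exactly on `[0, τ_ρ)`. -/
def lifetime (ρ : ℂ) (b : ℝ≥0 → ℂ) : ℝ≥0∞ :=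
  ⨆ (T : ℝ≥0) (_ : ∃ δ : ℝ → ℂ, IsDriftSolution ρ b T δ), (T : ℝ≥0∞)

open Classical in
/-- The value at time `t` of the (unique) maximal solution `δ_ρ`; meaningful for `t < τ_ρ`. -/
def drift (ρ : ℂ) (b : ℝ≥0 → ℂ) (t : ℝ≥0) : ℂ :=
  if h : ∃ δ : ℝ → ℂ, IsDriftSolution ρ b t δ then h.choose t else 0

/-- The path `b + δ_ρ`, meaningful on `[0, τ_ρ)`. -/
def conditioned (ρ : ℂ) (b : ℝ≥0 → ℂ) (t : ℝ≥0) : ℂ := b t + drift ρ b t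

/-! ### The radial Loewner equation -/

/-- The point `e^{i ξ(t)}`. -/
def drivePoint (ξ : ℝ≥0 → ℝ) (t : ℝ≥0) : ℂ := Complex.exp (Complex.I * (ξ t : ℂ))

/-- `w` solves the radial Loewner equation driven by `ξ`, started from `z`, on `[0, T]`. -/
def IsLoewnerSolution (ξ : ℝ≥0 → ℝ) (z : ℂ) (T : ℝ≥0) (w : ℝ → ℂ) : Prop :=
  w 0 = z ∧ ∀ t ∈ Icc (0 : ℝ) T,
    w t ≠ drivePoint ξ t.toNNReal ∧
    HasDerivWithinAt w
      (w t * ((drivePoint ξ t.toNNReal + w t) / (drivePoint ξ t.toNNReal - w t)))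
      (Icc (0 : ℝ) T) t

/-- The domain `D_t` of the Loewner map `g_t`: the points of the unit disc from which the solution
exists up to and including time `t`. -/
def loewnerDomain (ξ : ℝ≥0 → ℝ) (t : ℝ≥0) : Set ℂ :=
  {z | z ∈ Metric.ball (0 : ℂ) 1 ∧ ∃ w : ℝ → ℂ, IsLoewnerSolution ξ z t w}

open Classical in
/-- The Loewner map `g_t`, meaningful on `D_t`. -/
def loewnerMap (ξ : ℝ≥0 → ℝ) (t : ℝ≥0) (z : ℂ) : ℂ :=
  if h : ∃ w : ℝ → ℂ, IsLoewnerSolution ξ z t w then h.choose t else 0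

/-- `β` is the curve (trace) of the radial Loewner equation driven by `ξ`: a continuous curve with
`β(t) = lim g_t⁻¹(z)` as `z → e^{i ξ(t)}` in the unit disc, for all `t ≥ 0`. -/
def IsLoewnerCurve (ξ : ℝ≥0 → ℝ) (β : ℝ≥0 → ℂ) : Prop :=
  Continuous β ∧ ∀ t : ℝ≥0,
    Tendsto (Function.invFunOn (loewnerMap ξ t) (loewnerDomain ξ t))
      (𝓝[Metric.ball (0 : ℂ) 1] (drivePoint ξ t)) (𝓝 (β t))

/-- The function `Q_t = P_{e^{i ξ(t)}} ∘ g_t`, meaningful on `D_t`. -/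
def loewnerPoisson (ξ : ℝ≥0 → ℝ) (t : ℝ≥0) (z : ℂ) : ℝ :=
  diskPoisson (drivePoint ξ t) (loewnerMap ξ t z)

/-! ### Processes -/

/-- The driving function `√κ B` of radial SLE with parameter `κ`. -/
def driving (κ : ℝ) (b : ℝ≥0 → ℝ) (t : ℝ≥0) : ℝ := √κ * b t

/-- A standard complex Brownian motion: the real and imaginary parts are independent standard real
Brownian motions. -/
structure IsComplexBrownian {Ω : Type*} [MeasurableSpace Ω] (Z : ℝ≥0 → Ω → ℂ) (P : Measure Ω) :
    Prop where
  re : IsBrownianReal (fun t ω ↦ (Z t ω).re) P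
  im : IsBrownianReal (fun t ω ↦ (Z t ω).im) P
  indep : IndepFun (fun ω (t : ℝ≥0) ↦ (Z t ω).re) (fun ω (t : ℝ≥0) ↦ (Z t ω).im) P

/-- `β` is the standard radial SLE curve with parameter `κ` driven by `√κ B`. -/
structure IsRadialSLE {Ω : Type*} [MeasurableSpace Ω] (κ : ℝ) (B : ℝ≥0 → Ω → ℝ)
    (β : ℝ≥0 → Ω → ℂ) (P : Measure Ω) : Prop where
  brownian : IsBrownianReal B P
  curve : ∀ᵐ ω ∂P, IsLoewnerCurve (driving κ (fun t ↦ B t ω)) (fun t ↦ β t ω)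

/-- The first time at which a path `X` with lifetime `τ` hits `σ` (`∞` if it does not). -/
def hitTime (X : ℝ≥0 → ℂ) (τ : ℝ≥0∞) (σ : Set ℂ) : ℝ≥0∞ :=
  ⨅ (t : ℝ≥0) (_ : (t : ℝ≥0∞) < τ ∧ X t ∈ σ), (t : ℝ≥0∞)

/-- The set `𝒟` of all `(t₁, t₂)` in `[0, τ) × [0, ∞)` with `X[0, t₁] ∩ β[0, t₂] = ∅`. -/
def disjointTimes (X : ℝ≥0 → ℂ) (τ : ℝ≥0∞) (β : ℝ≥0 → ℂ) : Set (ℝ≥0 × ℝ≥0) :=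
  {p | (p.1 : ℝ≥0∞) < τ ∧ Disjoint (X '' Icc 0 p.1) (β '' Icc 0 p.2)}

/-- The ratio `M(t₁, t₂) = Q_{t₂}(X(t₁)) / Q_0(X(t₁))`. -/
def ratioM (ξ : ℝ≥0 → ℝ) (X : ℝ≥0 → ℂ) (t₁ t₂ : ℝ≥0) : ℝ :=
  loewnerPoisson ξ t₂ (X t₁) / loewnerPoisson ξ 0 (X t₁)

end

end LoopErasure

namespace LoopErasure

open MeasureTheory ProbabilityTheory Set Filter Topology
open scoped NNReal ENNReal ComplexConjugate

/-! ### Nonautonomous equations `w' = f (a t, w)` -/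

/-! The bound is pathwise. Since `g_t(0) = 0`, `Q_t` is the real part of a holomorphic function with
positive real part and value `1` at `0` (`exists_isCaratheodory_loewnerPoisson`). Let `V` be the
component of `0` off `σ₂`, and `K` the closure of the component of `0` off `σ₁`; then `K` is a
compact subset of `V` (`closure_subset_of_mem_jordanPairs`). Harnack's inequality bounds `|ln Re h|`
on `K` uniformly over all such functions `h` on `V` (`exists_forall_abs_log_re_le`); applied to
`Q_{t₂}` and to `Q_0`, this bounds `ln M`.

It remains to place the conditioned path in `K` (`conditioned_mem_closure`) and `V` in `D_{t₂}`. The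
trace starts on the unit circle, so it cannot enter `V` without first hitting `σ₂`
(`disjoint_of_le_hitTime`). A compact connected set that contains `0` and avoids the trace is not
swallowed (`subset_loewnerDomain`): at the first time `T` when it leaves the domain, it has a point
`z` outside `D_T` that is a limit of points of `D_T`. There `g_T` tends to the driving point
(`tendsto_loewnerMap_of_swallowed`), so the limit defining the trace gives `β(T) = z`.

Both differential equations are handled through `exists_flow`, and the planar topology needs only
rays, connectedness and compactness, not the Jordan curve theorem. -/

/-- `w` solves `w' = f (a, w)`, `w 0 = x`, on `[0, T]`, with `(a, w)` in `U`. -/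
def IsSolution (f : ℂ × ℂ → ℂ) (U : Set (ℂ × ℂ)) (a : ℝ → ℂ) (x : ℂ) (T : ℝ) (w : ℝ → ℂ) : Prop :=
  w 0 = x ∧ ∀ t ∈ Icc 0 T, (a t, w t) ∈ U ∧ HasDerivWithinAt w (f (a t, w t)) (Icc 0 T) t

lemma exists_bounded_lipschitz_extension {f : ℂ × ℂ → ℂ} {S : Set (ℂ × ℂ)} {K : ℝ≥0}
    (hf : LipschitzOnWith K f S) (hb : ∃ R, ∀ p ∈ S, ‖f p‖ ≤ R) :
    ∃ (F : ℂ × ℂ → ℂ) (K' L : ℝ≥0), LipschitzWith K' F ∧ (∀ p, ‖F p‖ ≤ L) ∧ EqOn f F S := by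
  obtain ⟨R, hR⟩ := hb
  have real_case (g : ℂ × ℂ → ℝ) (hg : LipschitzOnWith K g S) (hgR : ∀ p ∈ S, |g p| ≤ R) :
      ∃ G : ℂ × ℂ → ℝ, LipschitzWith K G ∧ (∀ p, |G p| ≤ |R|) ∧ EqOn g G S := by
    obtain ⟨G, hG, hGg⟩ := hg.extend_real
    refine ⟨fun p ↦ max (-|R|) (min |R| (G p)), (hG.const_min |R|).const_max (-|R|), fun p ↦ ?_,
      fun p hp ↦ ?_⟩
    · exact abs_le.2 ⟨le_max_left _ _, max_le (by linarith [abs_nonneg R]) (min_le_left _ _)⟩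
    · have h := abs_le.1 ((hgR p hp).trans (le_abs_self R))
      simp only [← hGg hp, min_eq_right h.2, max_eq_right h.1]
  obtain ⟨G₁, h₁, hb₁, he₁⟩ := real_case (fun p ↦ (f p).re)
    (LipschitzOnWith.of_dist_le_mul fun p hp q hq ↦ by
      refine le_trans ?_ (hf.dist_le_mul p hp q hq)
      rw [Real.dist_eq, Complex.dist_eq, ← Complex.sub_re]
      exact Complex.abs_re_le_norm _)
    (fun p hp ↦ (Complex.abs_re_le_norm _).trans (hR p hp))
  obtain ⟨G₂, h₂, hb₂, he₂⟩ := real_case (fun p ↦ (f p).im)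
    (LipschitzOnWith.of_dist_le_mul fun p hp q hq ↦ by
      refine le_trans ?_ (hf.dist_le_mul p hp q hq)
      rw [Real.dist_eq, Complex.dist_eq, ← Complex.sub_im]
      exact Complex.abs_im_le_norm _)
    (fun p hp ↦ (Complex.abs_im_le_norm _).trans (hR p hp))
  refine ⟨fun p ↦ ⟨G₁ p, G₂ p⟩, K + K, ⟨|R| + |R|, by positivity⟩, ?_, ?_, ?_⟩
  · refine LipschitzWith.of_dist_le_mul fun p q ↦ ?_
    have e₁ := h₁.dist_le_mul p q
    have e₂ := h₂.dist_le_mul p q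
    rw [Real.dist_eq] at e₁ e₂
    rw [Complex.dist_eq]
    refine (Complex.norm_le_abs_re_add_abs_im _).trans ?_
    simp only [Complex.sub_re, Complex.sub_im, NNReal.coe_add]
    linarith
  · intro p
    refine (Complex.norm_le_abs_re_add_abs_im _).trans ?_
    exact add_le_add (hb₁ p) (hb₂ p)
  · intro p hp
    exact Complex.ext (he₁ hp) (he₂ hp)

lemma HasDerivWithinAt.Ici_of_Icc {w : ℝ → ℂ} {w' : ℂ} {T t : ℝ} (ht : t ∈ Ico 0 T)
    (h : HasDerivWithinAt w w' (Icc 0 T) t) : HasDerivWithinAt w w' (Ici t) t :=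
  h.mono_of_mem_nhdsWithin (Icc_mem_nhdsGE_of_mem ht)

section Solutions

variable {f : ℂ × ℂ → ℂ} {U S : Set (ℂ × ℂ)} {a : ℝ → ℂ} {x : ℂ} {T : ℝ} {w : ℝ → ℂ}

lemma IsSolution.continuousOn (h : IsSolution f U a x T w) : ContinuousOn w (Icc 0 T) :=
  fun t ht ↦ (h.2 t ht).2.continuousWithinAt

lemma IsSolution.mono (h : IsSolution f U a x T w) {T' : ℝ} (hT : T' ≤ T) :
    IsSolution f U a x T' w :=
  ⟨h.1, fun t ht ↦ ⟨(h.2 t ⟨ht.1, ht.2.trans hT⟩).1,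
    (h.2 t ⟨ht.1, ht.2.trans hT⟩).2.mono (Icc_subset_Icc_right hT)⟩⟩

/-- The flow of a globally Lipschitz modification of `f` off the compact set `S`. -/
theorem exists_flow (hf : LocallyLipschitzOn U f) (ha : Continuous a) (hS : IsCompact S)
    (hSU : S ⊆ U) (hT : 0 ≤ T) :
    ∃ (Φ : ℂ → ℝ → ℂ) (K : ℝ), 0 < K ∧ (∀ x, Φ x 0 = x) ∧ (∀ x, ContinuousOn (Φ x) (Icc 0 T)) ∧
      (∀ x y, ∀ t ∈ Icc 0 T, dist (Φ x t) (Φ y t) ≤ K * dist x y) ∧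
      (∀ x, ∀ T' ≤ T, (∀ t ∈ Icc 0 T', (a t, Φ x t) ∈ S) → IsSolution f U a x T' (Φ x)) ∧
      (∀ x w, ∀ T' ≤ T, IsSolution f U a x T' w → (∀ t ∈ Icc 0 T', (a t, w t) ∈ S) →
        EqOn w (Φ x) (Icc 0 T')) := by
  obtain ⟨K₀, hK₀⟩ := (hf.mono hSU).exists_lipschitzOnWith_of_compact hS
  obtain ⟨F, K, L, hK, hL, hF⟩ := exists_bounded_lipschitz_extension hK₀
    (hS.exists_bound_of_continuousOn hK₀.continuousOn)
  have hV (t : ℝ) : LipschitzWith K fun y ↦ F (a t, y) := by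
    simpa using! hK.comp (LipschitzWith.prodMk_left (a t))
  have hsol (x : ℂ) : ∃ w : ℝ → ℂ, w 0 = x ∧
      ∀ t ∈ Icc 0 T, HasDerivWithinAt w (F (a t, w t)) (Icc 0 T) t := by
    -- The global bound `L` confines solutions to the ball of radius `L * T`, so Picard–Lindelöf
    -- covers all of `[0, T]` at once.
    have hP : IsPicardLindelof (fun t y ↦ F (a t, y)) (⟨0, by simp [hT]⟩ : Icc 0 T) x
        (L * T.toNNReal) 0 L K :=
      { lipschitzOnWith := fun t _ ↦ (hV t).lipschitzOnWith
        continuousOn := fun y _ ↦ (hK.continuous.comp (by fun_prop)).continuousOn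
        norm_le := fun t _ y _ ↦ hL _
        mul_max_le := by simp [hT] }
    exact hP.exists_eq_forall_mem_Icc_hasDerivWithinAt₀
  choose Φ hΦ₀ hΦ using hsol
  have hΦc (x : ℂ) : ContinuousOn (Φ x) (Icc 0 T) := fun t ht ↦ (hΦ x t ht).continuousWithinAt
  refine ⟨Φ, Real.exp (K * T), Real.exp_pos _, hΦ₀, hΦc, fun x y t ht ↦ ?_, fun x T' hT' h ↦ ?_,
    fun x w T' hT' hw hwS ↦ ?_⟩
  · have := dist_le_of_trajectories_ODE (v := fun t y ↦ F (a t, y)) hV (hΦc x)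
      (fun t ht ↦ HasDerivWithinAt.Ici_of_Icc ht (hΦ x t (Ico_subset_Icc_self ht))) (hΦc y)
      (fun t ht ↦ HasDerivWithinAt.Ici_of_Icc ht (hΦ y t (Ico_subset_Icc_self ht)))
      (le_refl _) t ht
    rw [hΦ₀, hΦ₀] at this
    rw [mul_comm]
    refine this.trans ?_
    gcongr
    linarith [ht.2]
  · refine ⟨hΦ₀ x, fun t ht ↦ ⟨hSU (h t ht), ?_⟩⟩
    rw [hF (h t ht)]
    exact (hΦ x t ⟨ht.1, ht.2.trans hT'⟩).mono (Icc_subset_Icc_right hT')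
  · refine ODE_solution_unique (v := fun t y ↦ F (a t, y)) hV hw.continuousOn (fun t ht ↦ ?_)
      ((hΦc x).mono (Icc_subset_Icc_right hT')) (fun t ht ↦ ?_) (hw.1.trans (hΦ₀ x).symm)
    · rw [← hF (hwS t (Ico_subset_Icc_self ht))]
      exact HasDerivWithinAt.Ici_of_Icc ht (hw.2 t (Ico_subset_Icc_self ht)).2
    · exact HasDerivWithinAt.Ici_of_Icc ⟨ht.1, ht.2.trans_le hT'⟩
        (hΦ x t ⟨ht.1, ht.2.le.trans hT'⟩)

lemma IsSolution.isCompact_graph (h : IsSolution f U a x T w) (ha : Continuous a) :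
    IsCompact ((fun t ↦ (a t, w t)) '' Icc 0 T) :=
  isCompact_Icc.image_of_continuousOn (ha.continuousOn.prodMk h.continuousOn)

lemma IsSolution.graph_subset (h : IsSolution f U a x T w) :
    (fun t ↦ (a t, w t)) '' Icc 0 T ⊆ U := by
  rintro _ ⟨t, ht, rfl⟩
  exact (h.2 t ht).1

theorem IsSolution.eqOn (hf : LocallyLipschitzOn U f) (ha : Continuous a)
    (h : IsSolution f U a x T w) {w' : ℝ → ℂ} (h' : IsSolution f U a x T w') :
    EqOn w w' (Icc 0 T) := by
  rcases lt_or_ge T 0 with hT | hT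
  · simp [Icc_eq_empty hT.not_ge]
  obtain ⟨Φ, K, -, -, -, -, -, hΦ⟩ := exists_flow hf ha
    ((h.isCompact_graph ha).union (h'.isCompact_graph ha))
    (union_subset h.graph_subset h'.graph_subset) hT
  exact (hΦ x w T le_rfl h fun t ht ↦ Or.inl (mem_image_of_mem _ ht)).trans
    (hΦ x w' T le_rfl h' fun t ht ↦ Or.inr (mem_image_of_mem _ ht)).symm

/-- Solutions persist under small perturbations of the starting point and for a short while. -/
theorem IsSolution.stable (hU : IsOpen U) (hf : LocallyLipschitzOn U f) (ha : Continuous a)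
    (hT : 0 ≤ T) (h : IsSolution f U a x T w) :
    ∃ ε > 0, ∃ K > 0, ∀ y, dist y x < ε →
      ∃ w', IsSolution f U a y (T + ε) w' ∧ ∀ t ∈ Icc 0 T, dist (w' t) (w t) ≤ K * dist y x := by
  obtain ⟨δ, hδ, hδU⟩ := (h.isCompact_graph ha).exists_cthickening_subset_open hU h.graph_subset
  obtain ⟨Φ, K, hK, hΦ₀, hΦc, hΦd, hΦs, hΦu⟩ := exists_flow (T := T + 1) hf ha
    (h.isCompact_graph ha).cthickening hδU (by linarith)
  have hw : EqOn w (Φ x) (Icc 0 T) := hΦu x w T (by linarith) h fun t ht ↦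
    Metric.self_subset_cthickening _ (mem_image_of_mem _ ht)
  have hcont : ContinuousWithinAt (fun t ↦ (a t, Φ x t)) (Icc 0 (T + 1)) T :=
    ha.continuousWithinAt.prodMk (hΦc x T ⟨hT, by linarith⟩)
  obtain ⟨η, hη, hηT⟩ := Metric.continuousWithinAt_iff.1 hcont (δ / 2) (by linarith)
  -- Half of the margin `δ` pays for moving the starting point, the other half for running past `T`;
  -- the bound `1` keeps within the flow's interval.
  have hε : 0 < min (min (η / 2) 1) (δ / (2 * K)) := by positivity
  refine ⟨_, hε, K, hK, fun y hy ↦ ⟨Φ y, hΦs y _ ?_ fun t ht ↦ ?_, fun t ht ↦ ?_⟩⟩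
  · linarith [min_le_left (min (η / 2) 1) (δ / (2 * K)), min_le_right (η / 2) 1]
  · have ht1 : t ≤ T + 1 := by
      linarith [ht.2, min_le_left (min (η / 2) 1) (δ / (2 * K)), min_le_right (η / 2) 1]
    have ht2 : t < T + η := by
      linarith [ht.2, min_le_left (min (η / 2) 1) (δ / (2 * K)), min_le_left (η / 2) 1]
    have hyx : dist (a t, Φ y t) (a t, Φ x t) ≤ δ / 2 := by
      rw [Prod.dist_eq, dist_self, max_eq_right dist_nonneg]
      refine (hΦd y x t ⟨ht.1, ht1⟩).trans ?_
      have := (hy.trans_le (min_le_right _ _)).le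
      calc K * dist y x ≤ K * (δ / (2 * K)) := by gcongr
        _ = δ / 2 := by field_simp
    rcases le_total t T with h1 | h1
    · refine Metric.mem_cthickening_of_dist_le _ (a t, w t) _ _ (mem_image_of_mem _ ⟨ht.1, h1⟩) ?_
      rw [hw ⟨ht.1, h1⟩]
      linarith
    · refine Metric.mem_cthickening_of_dist_le _ (a T, w T) _ _
        (mem_image_of_mem _ (right_mem_Icc.2 hT)) ?_
      have := hηT ⟨ht.1, ht1⟩ (by rw [Real.dist_eq, abs_lt]; constructor <;> linarith)
      rw [hw (right_mem_Icc.2 hT)]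
      linarith [dist_triangle (a t, Φ y t) (a t, Φ x t) (a T, Φ x T)]
  · rw [hw ht]
    exact hΦd y x t ⟨ht.1, by linarith [ht.2]⟩

/-- A solution on `[0, T)` whose graph stays in a compact set extends to `[0, T]`. -/
theorem exists_isSolution_of_forall_lt (hf : LocallyLipschitzOn U f) (ha : Continuous a)
    (hT : 0 < T) (hS : IsCompact S) (hSU : S ⊆ U)
    (h : ∀ t ∈ Ico 0 T, ∃ w, IsSolution f U a x t w ∧ ∀ s ∈ Icc 0 t, (a s, w s) ∈ S) :
    ∃ w, IsSolution f U a x T w := by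
  obtain ⟨Φ, K, hK, hΦ₀, hΦc, hΦd, hΦs, hΦu⟩ := exists_flow hf ha hS hSU hT.le
  have hlt (t) (ht : t ∈ Ico 0 T) : (a t, Φ x t) ∈ S := by
    obtain ⟨w, hw, hwS⟩ := h t ht
    rw [← hΦu x w t ht.2.le hw hwS (right_mem_Icc.2 ht.1)]
    exact hwS t (right_mem_Icc.2 ht.1)
  refine ⟨Φ x, hΦs x T le_rfl fun t ht ↦ ?_⟩
  have hg : ContinuousOn (fun t ↦ (a t, Φ x t)) (Icc 0 T) := ha.continuousOn.prodMk (hΦc x)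
  rw [← closure_Ico hT.ne] at hg ht
  exact hS.isClosed.closure_subset (hg.image_closure.trans
    (closure_mono (image_subset_iff.2 hlt)) (mem_image_of_mem _ ht))

end Solutions

/-! ### Harnack's inequality for real parts of holomorphic functions -/

lemma norm_sub_le_norm_add_conj {a b : ℂ} (ha : 0 < a.re) (hb : 0 < b.re) :
    ‖a - b‖ ≤ ‖a + conj b‖ := by
  rw [Complex.norm_def, Complex.norm_def]
  refine Real.sqrt_le_sqrt ?_
  simp only [Complex.normSq_apply, Complex.sub_re, Complex.sub_im, Complex.add_re, Complex.add_im,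
    Complex.conj_re, Complex.conj_im]
  nlinarith

lemma norm_add_conj_le (a b : ℂ) (hb : 0 < b.re) : ‖a + conj b‖ ≤ ‖a - b‖ + 2 * b.re := by
  have : a + conj b = (a - b) + ((2 * b.re : ℝ) : ℂ) := by
    rw [← Complex.add_conj]
    ring
  rw [this]
  refine (norm_add_le _ _).trans ?_
  rw [Complex.norm_real, Real.norm_of_nonneg (by positivity)]

/-- The Cayley map centred at `h c` takes the right half-plane to the disc. The Schwarz lemma at
relative distance `1/2` then gives `‖h z - h c‖ ≤ ‖h z + conj (h c)‖ / 2`, hence a distance of at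
most twice either real part, and the factor `3`. -/
theorem abs_log_re_sub_log_re_le {h : ℂ → ℂ} {c z : ℂ} {R : ℝ}
    (hd : DifferentiableOn ℂ h (Metric.ball c R)) (hpos : ∀ w ∈ Metric.ball c R, 0 < (h w).re)
    (hz : dist z c < R / 2) : |Real.log (h z).re - Real.log (h c).re| ≤ Real.log 3 := by
  have hR : 0 < R := by linarith [dist_nonneg (x := z) (y := c)]
  have hzR : z ∈ Metric.ball c R := by
    rw [Metric.mem_ball]
    linarith
  have hcp := hpos c (Metric.mem_ball_self hR)
  have hzp := hpos z hzR
  have hne (w) (hw : w ∈ Metric.ball c R) : h w + conj (h c) ≠ 0 := fun h0 ↦ by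
    have := congrArg Complex.re h0
    simp only [Complex.add_re, Complex.conj_re, Complex.zero_re] at this
    linarith [hpos w hw]
  have key := Complex.dist_le_div_mul_dist_of_mapsTo_ball
    (f := fun w ↦ (h w - h c) / (h w + conj (h c))) (R₂ := 1) (z := z)
    ((hd.sub_const _).div (hd.add_const _) hne) (fun w hw ↦ by
      simp only [sub_self, zero_div, mem_closedBall_zero_iff, norm_div]
      exact div_le_one_of_le₀ (norm_sub_le_norm_add_conj (hpos w hw) hcp) (norm_nonneg _)) hzR
  simp only [sub_self, zero_div, dist_zero_right, norm_div] at key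
  have hhalf : ‖h z - h c‖ ≤ 1 / 2 * ‖h z + conj (h c)‖ := by
    rw [← div_le_iff₀ (norm_pos_iff.2 (hne z hzR))]
    refine key.trans ?_
    rw [div_mul_eq_mul_div, one_mul, div_le_iff₀ hR]
    linarith
  have h1 := norm_add_conj_le (h z) (h c) hcp
  have h2 := norm_add_conj_le (h c) (h z) hzp
  have hcomm : ‖h c + conj (h z)‖ = ‖h z + conj (h c)‖ := by
    rw [← Complex.norm_conj]
    simp [add_comm]
  rw [hcomm, norm_sub_rev] at h2
  have hre := abs_le.1 ((Complex.abs_re_le_norm (h z - h c)))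
  rw [Complex.sub_re] at hre
  rw [abs_le]
  constructor
  · have := Real.log_le_log hcp (show (h c).re ≤ 3 * (h z).re by linarith)
    rw [Real.log_mul (by norm_num) hzp.ne'] at this
    linarith
  · have := Real.log_le_log hzp (show (h z).re ≤ 3 * (h c).re by linarith)
    rw [Real.log_mul (by norm_num) hcp.ne'] at this
    linarith

/-- Holomorphic functions on `V` with positive real part and value `1` at `0`. -/
def IsCaratheodory (V : Set ℂ) (h : ℂ → ℂ) : Prop :=
  DifferentiableOn ℂ h V ∧ (∀ z ∈ V, 0 < (h z).re) ∧ h 0 = 1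

/-- The points of `V` with a bound uniform in `h` form a set that contains `0` and is open and
relatively closed in `V`, since a Harnack step costs only `log 3`. Compactness of `K` makes the
bound uniform in `z`. -/
theorem exists_forall_abs_log_re_le {V K : Set ℂ} (hVo : IsOpen V) (hVc : IsPreconnected V)
    (h0 : 0 ∈ V) (hK : IsCompact K) (hKV : K ⊆ V) :
    ∃ C, ∀ h, IsCaratheodory V h → ∀ z ∈ K, |Real.log (h z).re| ≤ C := by
  let A : Set ℂ := {z | z ∈ V ∧ ∃ C, ∀ h, IsCaratheodory V h → |Real.log (h z).re| ≤ C}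
  have step {c z R} (hR : Metric.ball c R ⊆ V) (hz : dist z c < R / 2) (h) (hh : IsCaratheodory V h) :=
    abs_log_re_sub_log_re_le (hh.1.mono hR) (fun w hw ↦ hh.2.1 w (hR hw)) hz
  have near {c R} (hR : 0 < R) (hcR : Metric.ball c R ⊆ V) (hc : c ∈ A) :
      ∃ C, ∀ h, IsCaratheodory V h → ∀ z ∈ Metric.ball c (R / 2), |Real.log (h z).re| ≤ C := by
    obtain ⟨-, C, hC⟩ := hc
    refine ⟨Real.log 3 + C, fun h hh z hz ↦ ?_⟩
    have h1 := step hcR hz h hh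
    have h2 := hC h hh
    rw [abs_le] at *
    constructor <;> linarith
  have hAo : IsOpen A := by
    refine Metric.isOpen_iff.2 fun c hc ↦ ?_
    obtain ⟨R, hR, hcR⟩ := Metric.isOpen_iff.1 hVo c hc.1
    obtain ⟨C, hC⟩ := near hR hcR hc
    exact ⟨R / 2, by linarith, fun z hz ↦ ⟨hcR (Metric.ball_subset_ball (by linarith) hz), C,
      fun h hh ↦ hC h hh z hz⟩⟩
  have hVA : V ⊆ A := by
    refine hVc.subset_of_closure_inter_subset hAo ⟨0, h0, h0, 0, fun h hh ↦ by simp [hh.2.2]⟩ ?_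
    rintro z ⟨hzA, hzV⟩
    obtain ⟨R, hR, hzR⟩ := Metric.isOpen_iff.1 hVo z hzV
    obtain ⟨c, hc, hzc⟩ := Metric.mem_closure_iff.1 hzA (R / 2) (by linarith)
    obtain ⟨-, C, hC⟩ := hc
    refine ⟨hzV, Real.log 3 + C, fun h hh ↦ ?_⟩
    have h1 := step hzR (by rwa [dist_comm]) h hh
    have h2 := hC h hh
    rw [abs_le] at *
    constructor <;> linarith
  refine hK.induction_on (p := fun K ↦ ∃ C, ∀ h, IsCaratheodory V h → ∀ z ∈ K,
    |Real.log (h z).re| ≤ C) ⟨0, by simp⟩ (fun s t hst ⟨C, hC⟩ ↦ ⟨C, fun h hh z hz ↦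
      hC h hh z (hst hz)⟩) (fun s t ⟨C, hC⟩ ⟨C', hC'⟩ ↦ ⟨max C C', fun h hh z hz ↦ ?_⟩)
      fun c hc ↦ ?_
  · rcases hz with hz | hz
    · exact (hC h hh z hz).trans (le_max_left _ _)
    · exact (hC' h hh z hz).trans (le_max_right _ _)
  · obtain ⟨R, hR, hcR⟩ := Metric.isOpen_iff.1 hVo c (hKV hc)
    exact ⟨_, mem_nhdsWithin_of_mem_nhds (Metric.ball_mem_nhds c (half_pos hR)),
      near hR hcR (hVA (hKV hc))⟩

/-! ### Linear equations -/

/-- The product of `y` with `exp (-∫ A)` has derivative zero. The point is that such a `y` never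
vanishes unless `y 0 = 0`. -/
lemma eq_mul_exp_integral {y A : ℝ → ℂ} {T : ℝ} (hA : ContinuousOn A (Icc 0 T))
    (hy : ∀ t ∈ Icc 0 T, HasDerivWithinAt y (A t * y t) (Icc 0 T) t) :
    ∀ t ∈ Icc 0 T, y t = y 0 * Complex.exp (∫ s in 0..t, A s) := by
  intro t ht
  have hT : 0 ≤ T := ht.1.trans ht.2
  -- Extending `A` by constants makes its primitive differentiable at the endpoints too.
  have hA' : Continuous (IccExtend hT ((Icc 0 T).domRestrict A)) :=
    (continuousOn_iff_continuous_domRestrict.1 hA).Icc_extend'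
  have hEq (s) (hs : s ∈ Icc 0 T) : IccExtend hT ((Icc 0 T).domRestrict A) s = A s := by
    rw [IccExtend_of_mem hT _ hs, domRestrict_apply]
  set G : ℝ → ℂ := fun t ↦ ∫ s in 0..t, IccExtend hT ((Icc 0 T).domRestrict A) s with hG
  have hGd (s) : HasDerivAt G (IccExtend hT ((Icc 0 T).domRestrict A) s) s :=
    hA'.integral_hasStrictDerivAt 0 s |>.hasDerivAt
  have hGt : G t = ∫ s in 0..t, A s := by
    refine intervalIntegral.integral_congr fun s hs ↦ hEq s ?_
    rw [uIcc_of_le ht.1] at hs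
    exact ⟨hs.1, hs.2.trans ht.2⟩
  have hd (s) (hs : s ∈ Icc 0 T) :
      HasDerivWithinAt (fun s ↦ y s * Complex.exp (-G s)) 0 (Icc 0 T) s := by
    have h1 := (hGd s).neg.cexp.hasDerivWithinAt (s := Icc 0 T)
    refine ((hy s hs).mul h1).congr_deriv ?_
    rw [hEq s hs]
    simp only [Pi.neg_apply]
    ring
  have := constant_of_has_deriv_right_zero (fun s hs ↦ (hd s hs).continuousWithinAt)
    (fun s hs ↦ HasDerivWithinAt.Ici_of_Icc hs (hd s (Ico_subset_Icc_self hs))) t ht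
  have hG0 : G 0 = 0 := by simp [hG]
  simp only [hG0, neg_zero, Complex.exp_zero, mul_one] at this
  rw [← this, ← hGt, mul_assoc, ← Complex.exp_add]
  simp

/-! ### The radial Loewner equation -/

noncomputable def loewnerField (p : ℂ × ℂ) : ℂ := p.2 * ((p.1 + p.2) / (p.1 - p.2))

def loewnerRegion : Set (ℂ × ℂ) := {p | p.2 ≠ p.1}

lemma isOpen_loewnerRegion : IsOpen loewnerRegion :=
  isOpen_ne_fun continuous_snd continuous_fst

lemma _root_.IsOpen.locallyLipschitzOn_of_contDiffOn {f : ℂ × ℂ → ℂ} {U : Set (ℂ × ℂ)}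
    (hU : IsOpen U) (hf : ContDiffOn ℝ 1 f U) : LocallyLipschitzOn U f := by
  intro p hp
  obtain ⟨K, t, ht, hK⟩ := (hf.contDiffAt (hU.mem_nhds hp)).exists_lipschitzOnWith
  exact ⟨K, t, mem_nhdsWithin_of_mem_nhds ht, hK⟩

lemma locallyLipschitzOn_loewnerField : LocallyLipschitzOn loewnerRegion loewnerField := by
  refine isOpen_loewnerRegion.locallyLipschitzOn_of_contDiffOn ?_
  refine ContDiffOn.congr (f := fun p : ℂ × ℂ ↦ p.2 * ((p.1 + p.2) * (p.1 - p.2)⁻¹)) ?_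
    fun p _ ↦ rfl
  refine contDiff_snd.contDiffOn.mul ((contDiff_fst.add contDiff_snd).contDiffOn.mul
    ((contDiff_fst.sub contDiff_snd).contDiffOn.inv fun p hp ↦ ?_))
  exact sub_ne_zero.2 (Ne.symm hp)

/-- The driving point as a function of real time. -/
noncomputable def driveReal (ξ : ℝ≥0 → ℝ) (t : ℝ) : ℂ := drivePoint ξ t.toNNReal

/-- Solutions of the radial Loewner equation up to a real time. -/
abbrev LoewnerSol (ξ : ℝ≥0 → ℝ) (z : ℂ) (T : ℝ) (w : ℝ → ℂ) : Prop :=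
  IsSolution loewnerField loewnerRegion (driveReal ξ) z T w

lemma norm_drivePoint (ξ : ℝ≥0 → ℝ) (t : ℝ≥0) : ‖drivePoint ξ t‖ = 1 := by
  rw [drivePoint, Complex.norm_exp_I_mul_ofReal]

lemma norm_driveReal (ξ : ℝ≥0 → ℝ) (t : ℝ) : ‖driveReal ξ t‖ = 1 := norm_drivePoint ξ _

lemma driveReal_mul_conj (ξ : ℝ≥0 → ℝ) (t : ℝ) : driveReal ξ t * conj (driveReal ξ t) = 1 := by
  rw [Complex.mul_conj, Complex.normSq_eq_norm_sq, norm_driveReal]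
  simp

lemma continuous_driveReal {ξ : ℝ≥0 → ℝ} (hξ : Continuous ξ) : Continuous (driveReal ξ) := by
  unfold driveReal drivePoint
  have : Continuous fun t : ℝ ↦ ξ t.toNNReal := hξ.comp continuous_real_toNNReal
  fun_prop

section Loewner

variable {ξ : ℝ≥0 → ℝ} {z : ℂ} {T : ℝ} {w : ℝ → ℂ}

lemma LoewnerSol.ne (h : LoewnerSol ξ z T w) {t : ℝ} (ht : t ∈ Icc 0 T) :
    driveReal ξ t - w t ≠ 0 := sub_ne_zero.2 (Ne.symm (h.2 t ht).1)

/-- The quantity `1 - |w|²` solves a linear equation with coefficient `-2|w|²/|e - w|²`, so it never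
vanishes and `|w|` cannot reach `1`. -/
theorem LoewnerSol.norm_lt_one (hξ : Continuous ξ) (hz : ‖z‖ < 1) (h : LoewnerSol ξ z T w) :
    ∀ t ∈ Icc 0 T, ‖w t‖ < 1 := by
  have hne (t) (ht : t ∈ Icc 0 T) :
      (driveReal ξ t - w t) * (conj (driveReal ξ t) - conj (w t)) ≠ 0 := by
    rw [← map_sub, mul_ne_zero_iff, map_ne_zero]
    exact ⟨h.ne ht, h.ne ht⟩
  set A : ℝ → ℂ := fun t ↦ -2 * (w t * conj (w t)) /
    ((driveReal ξ t - w t) * (conj (driveReal ξ t) - conj (w t))) with hA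
  have hwc := h.continuousOn
  have hec := (continuous_driveReal hξ).continuousOn (s := Icc 0 T)
  have hAc : ContinuousOn A (Icc 0 T) := by
    have h1 : ContinuousOn (fun t ↦ conj (w t)) (Icc 0 T) :=
      Complex.continuous_conj.comp_continuousOn hwc
    have h2 : ContinuousOn (fun t ↦ conj (driveReal ξ t)) (Icc 0 T) :=
      Complex.continuous_conj.comp_continuousOn hec
    exact ContinuousOn.div (by fun_prop) (by fun_prop) hne
  have hy := eq_mul_exp_integral (y := fun t ↦ 1 - w t * conj (w t)) hAc fun t ht ↦ by
    have hw := (h.2 t ht).2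
    have hw' : HasDerivWithinAt (fun t ↦ conj (w t)) (conj (loewnerField (driveReal ξ t, w t)))
        (Icc 0 T) t := hw.star
    refine ((hw.mul hw').const_sub 1).congr_deriv ?_
    have he := driveReal_mul_conj ξ t
    have h1 := h.ne ht
    have h2 : conj (driveReal ξ t) - conj (w t) ≠ 0 := by
      rw [← map_sub, map_ne_zero]
      exact h1
    simp only [loewnerField, hA, map_mul, map_div₀, map_add, map_sub]
    field_simp
    linear_combination (-2 * w t * conj (w t)) * he
  have hpos (t) (ht : t ∈ Icc 0 T) : 1 - ‖w t‖ ^ 2 ≠ 0 := by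
    have h0 : (1 : ℂ) - w 0 * conj (w 0) ≠ 0 := by
      rw [h.1, Complex.mul_conj, Complex.normSq_eq_norm_sq, ← Complex.ofReal_one,
        ← Complex.ofReal_sub, Complex.ofReal_ne_zero]
      nlinarith [norm_nonneg z]
    have := hy t ht
    rw [Complex.mul_conj (w t), Complex.normSq_eq_norm_sq, ← Complex.ofReal_one,
      ← Complex.ofReal_sub, Complex.ofReal_one] at this
    rw [← Complex.ofReal_ne_zero, this]
    exact mul_ne_zero h0 (Complex.exp_ne_zero _)
  intro t ht
  by_contra! hcon
  have hsub : Icc 0 t ⊆ Icc 0 T := Icc_subset_Icc_right ht.2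
  obtain ⟨s, hs, hs1⟩ := intermediate_value_Icc ht.1 ((hwc.mono hsub).norm)
    (show (1 : ℝ) ∈ Icc ‖w 0‖ ‖w t‖ from ⟨by rw [h.1]; exact hz.le, hcon⟩)
  exact hpos s (hsub hs) (by simp only at hs1; rw [hs1]; norm_num)

/-! ### Differences of Loewner solutions; elementary properties of `D_t` and `g_t` -/

/-- The logarithmic derivative of the difference of two solutions. -/
noncomputable def loewnerDiff (e u v : ℂ) : ℂ := -1 + 2 * e ^ 2 / ((e - u) * (e - v))

lemma LoewnerSol.continuousOn_diff (hξ : Continuous ξ) (h : LoewnerSol ξ z T w) {z' : ℂ}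
    {w' : ℝ → ℂ} (h' : LoewnerSol ξ z' T w') :
    ContinuousOn (fun t ↦ loewnerDiff (driveReal ξ t) (w t) (w' t)) (Icc 0 T) := by
  have := h.continuousOn
  have := h'.continuousOn
  have := (continuous_driveReal hξ).continuousOn (s := Icc 0 T)
  refine continuousOn_const.add (ContinuousOn.div (by fun_prop) (by fun_prop) fun t ht ↦ ?_)
  exact mul_ne_zero (h.ne ht) (h'.ne ht)

/-- The difference of two solutions solves a linear equation. This formula yields both the
injectivity of `g_t` and its complex derivative. -/
theorem LoewnerSol.sub_eq (hξ : Continuous ξ) (h : LoewnerSol ξ z T w) {z' : ℂ}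
    {w' : ℝ → ℂ} (h' : LoewnerSol ξ z' T w') (hT : 0 ≤ T) :
    w T - w' T = (z - z') *
      Complex.exp (∫ s in 0..T, loewnerDiff (driveReal ξ s) (w s) (w' s)) := by
  have := eq_mul_exp_integral (y := fun t ↦ w t - w' t) (h.continuousOn_diff hξ h') (fun t ht ↦ by
    refine ((h.2 t ht).2.sub (h'.2 t ht).2).congr_deriv ?_
    have h1 := h.ne ht
    have h2 := h'.ne ht
    simp only [loewnerField, loewnerDiff]
    field_simp
    ring) T (right_mem_Icc.2 hT)
  simpa only [h.1, h'.1] using this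

lemma mem_loewnerDomain {t : ℝ≥0} :
    z ∈ loewnerDomain ξ t ↔ ‖z‖ < 1 ∧ ∃ w, LoewnerSol ξ z t w := by
  rw [loewnerDomain, mem_ofPred_eq, mem_ball_zero_iff]
  rfl

lemma LoewnerSol.loewnerMap_eq (hξ : Continuous ξ) {t : ℝ≥0} (h : LoewnerSol ξ z t w) :
    loewnerMap ξ t z = w t := by
  have hex : ∃ w : ℝ → ℂ, IsLoewnerSolution ξ z t w := ⟨w, h⟩
  rw [loewnerMap, dif_pos hex]
  exact IsSolution.eqOn locallyLipschitzOn_loewnerField (continuous_driveReal hξ) hex.choose_spec h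
    (right_mem_Icc.2 t.coe_nonneg)

lemma loewnerSol_zero (ξ : ℝ≥0 → ℝ) (T : ℝ) : LoewnerSol ξ 0 T fun _ ↦ 0 := by
  refine ⟨rfl, fun s hs ↦ ⟨?_, ?_⟩⟩
  · intro h
    have := norm_driveReal ξ s
    simp only at h
    simp [← h] at this
  · simpa [loewnerField] using hasDerivWithinAt_const s (Icc 0 T) (0 : ℂ)

lemma zero_mem_loewnerDomain (ξ : ℝ≥0 → ℝ) (t : ℝ≥0) : (0 : ℂ) ∈ loewnerDomain ξ t :=
  mem_loewnerDomain.2 ⟨by simp, _, loewnerSol_zero ξ t⟩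

lemma loewnerMap_zero_right (hξ : Continuous ξ) (t : ℝ≥0) : loewnerMap ξ t 0 = 0 :=
  (loewnerSol_zero ξ t).loewnerMap_eq hξ

lemma loewnerDomain_zero (ξ : ℝ≥0 → ℝ) : loewnerDomain ξ 0 = Metric.ball 0 1 := by
  refine Subset.antisymm (fun z hz ↦ hz.1) fun z hz ↦ mem_loewnerDomain.2 ?_
  have hz1 := mem_ball_zero_iff.1 hz
  refine ⟨hz1, fun _ ↦ z, rfl, fun t ht ↦ ⟨?_, ?_⟩⟩
  · intro h
    simp only at h
    rw [h, norm_driveReal] at hz1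
    exact lt_irrefl _ hz1
  · rw [NNReal.coe_zero, Icc_self] at ht ⊢
    rw [mem_singleton_iff.1 ht]
    -- On a one-point interval the derivative condition is empty.
    exact hasDerivWithinAt_iff_hasFDerivWithinAt.2
      (HasFDerivWithinAt.of_subsingleton subsingleton_singleton)

lemma loewnerMap_zero_left (hξ : Continuous ξ) (hz : ‖z‖ < 1) : loewnerMap ξ 0 z = z := by
  obtain ⟨-, w, hw⟩ := mem_loewnerDomain.1
    (show z ∈ loewnerDomain ξ 0 by rw [loewnerDomain_zero]; simpa using hz)
  rw [hw.loewnerMap_eq hξ, NNReal.coe_zero, hw.1]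

lemma loewnerDomain_anti {s t : ℝ≥0} (hst : s ≤ t) : loewnerDomain ξ t ⊆ loewnerDomain ξ s := by
  intro z hz
  obtain ⟨h1, w, hw⟩ := mem_loewnerDomain.1 hz
  exact mem_loewnerDomain.2 ⟨h1, w, hw.mono (by exact_mod_cast hst)⟩

lemma norm_loewnerMap_lt_one (hξ : Continuous ξ) {t : ℝ≥0} (hz : z ∈ loewnerDomain ξ t) :
    ‖loewnerMap ξ t z‖ < 1 := by
  obtain ⟨h1, w, hw⟩ := mem_loewnerDomain.1 hz
  rw [hw.loewnerMap_eq hξ]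
  exact LoewnerSol.norm_lt_one hξ h1 hw t (right_mem_Icc.2 t.coe_nonneg)

lemma injOn_loewnerMap (hξ : Continuous ξ) (t : ℝ≥0) :
    InjOn (loewnerMap ξ t) (loewnerDomain ξ t) := by
  intro z hz z' hz' heq
  obtain ⟨-, w, hw⟩ := mem_loewnerDomain.1 hz
  obtain ⟨-, w', hw'⟩ := mem_loewnerDomain.1 hz'
  rw [hw.loewnerMap_eq hξ, hw'.loewnerMap_eq hξ, ← sub_eq_zero, hw.sub_eq hξ hw' t.coe_nonneg,
    mul_eq_zero] at heq
  exact sub_eq_zero.1 (heq.resolve_right (Complex.exp_ne_zero _))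

lemma LoewnerSol.stable (hξ : Continuous ξ) (hT : 0 ≤ T) (h : LoewnerSol ξ z T w) :
    ∃ ε > 0, ∃ K > 0, ∀ y, dist y z < ε →
      ∃ w', LoewnerSol ξ y (T + ε) w' ∧ ∀ t ∈ Icc 0 T, dist (w' t) (w t) ≤ K * dist y z :=
  IsSolution.stable isOpen_loewnerRegion locallyLipschitzOn_loewnerField
    (continuous_driveReal hξ) hT h

lemma exists_ball_subset_loewnerDomain (hξ : Continuous ξ) {t : ℝ≥0}
    (hz : z ∈ loewnerDomain ξ t) :
    ∃ ε > 0, ∀ s : ℝ≥0, (s : ℝ) ≤ t + ε → Metric.ball z ε ⊆ loewnerDomain ξ s := by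
  obtain ⟨h1, w, hw⟩ := mem_loewnerDomain.1 hz
  obtain ⟨ε, hε, K, -, hK⟩ := LoewnerSol.stable hξ t.coe_nonneg hw
  refine ⟨min ε (1 - ‖z‖), lt_min hε (sub_pos.2 h1), fun s hs y hy ↦ mem_loewnerDomain.2 ?_⟩
  rw [Metric.mem_ball, lt_min_iff] at hy
  obtain ⟨w', hw', -⟩ := hK y hy.1
  refine ⟨?_, w', hw'.mono (hs.trans (by gcongr; exact min_le_left _ _))⟩
  have := norm_le_norm_add_norm_sub' y z
  rw [← dist_eq_norm] at this
  linarith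

lemma isOpen_loewnerDomain (hξ : Continuous ξ) (t : ℝ≥0) : IsOpen (loewnerDomain ξ t) :=
  Metric.isOpen_iff.2 fun _ hz ↦
    let ⟨ε, hε, h⟩ := exists_ball_subset_loewnerDomain hξ hz
    ⟨ε, hε, h t (by linarith)⟩

lemma LoewnerSol.exists_le_norm (hξ : Continuous ξ) (h : LoewnerSol ξ z T w) :
    ∃ c > 0, ∀ t ∈ Icc 0 T, c ≤ ‖driveReal ξ t - w t‖ := by
  rcases lt_or_ge T 0 with hT | hT
  · exact ⟨1, one_pos, by simp [Icc_eq_empty hT.not_ge]⟩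
  obtain ⟨s, hs, hmin⟩ := isCompact_Icc.exists_isMinOn (nonempty_Icc.2 hT)
    (((continuous_driveReal hξ).continuousOn.sub h.continuousOn).norm)
  exact ⟨_, norm_pos_iff.2 (h.ne hs), fun t ht ↦ hmin ht⟩

/-- By `LoewnerSol.sub_eq` the difference quotient is exactly the exponential of an integral, which
converges by dominated convergence. -/
theorem differentiableAt_loewnerMap (hξ : Continuous ξ) {t : ℝ≥0} (hz : z ∈ loewnerDomain ξ t) :
    DifferentiableAt ℂ (loewnerMap ξ t) z := by
  obtain ⟨-, w, hw⟩ := mem_loewnerDomain.1 hz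
  obtain ⟨ε, hε, K, hK, hst⟩ := LoewnerSol.stable hξ t.coe_nonneg hw
  obtain ⟨c, hc, hcw⟩ := LoewnerSol.exists_le_norm hξ hw
  choose! W hW hWd using hst
  have hsol (y) (hy : dist y z < ε) : LoewnerSol ξ y t (W y) := (hW y hy).mono (by linarith)
  set E : ℂ → ℂ := fun y ↦ ∫ s in 0..(t : ℝ), loewnerDiff (driveReal ξ s) (W y s) (w s)
  set E₀ : ℂ := ∫ s in 0..(t : ℝ), loewnerDiff (driveReal ξ s) (w s) (w s)
  have hball (r : ℝ) (hr : 0 < r) : ∀ᶠ y in 𝓝 z, dist y z < r := Metric.ball_mem_nhds z hr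
  have hIcc {s} (hs : s ∈ uIoc 0 (t : ℝ)) : s ∈ Icc 0 (t : ℝ) := by
    rw [uIoc_of_le t.coe_nonneg] at hs
    exact Ioc_subset_Icc_self hs
  have hlim : Tendsto E (𝓝 z) (𝓝 E₀) := by
    refine intervalIntegral.tendsto_integral_filter_of_dominated_convergence
      (fun _ ↦ 1 + 2 / (c / 2 * c)) ?_ ?_ (by simp) ?_
    · filter_upwards [hball ε hε] with y hy
      refine ContinuousOn.aestronglyMeasurable ?_ measurableSet_uIoc
      exact ((hsol y hy).continuousOn_diff hξ hw).mono fun s hs ↦ hIcc hs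
    · filter_upwards [hball ε hε, hball (c / (2 * K)) (by positivity)] with y hy hy'
      refine Eventually.of_forall fun s hs ↦ ?_
      have h1 : c ≤ ‖driveReal ξ s - w s‖ := hcw s (hIcc hs)
      have h2 : ‖W y s - w s‖ ≤ c / 2 := by
        rw [← dist_eq_norm]
        refine (hWd y hy s (hIcc hs)).trans ?_
        calc K * dist y z ≤ K * (c / (2 * K)) := by gcongr
          _ = c / 2 := by field_simp
      have h3 : c / 2 ≤ ‖driveReal ξ s - W y s‖ := by
        have := norm_sub_le (driveReal ξ s - W y s) (-(W y s - w s))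
        rw [norm_neg, show driveReal ξ s - W y s - -(W y s - w s) = driveReal ξ s - w s by ring]
          at this
        linarith
      refine (norm_add_le _ _).trans ?_
      rw [norm_neg, norm_one, norm_div, norm_mul, norm_mul, norm_pow, norm_driveReal]
      simp only [Complex.norm_ofNat, one_pow, mul_one]
      gcongr
    · refine Eventually.of_forall fun s hs ↦ ?_
      have h1 : Tendsto (fun y ↦ W y s) (𝓝 z) (𝓝 (w s)) := by
        rw [tendsto_iff_dist_tendsto_zero]
        refine squeeze_zero' (Eventually.of_forall fun _ ↦ dist_nonneg)
          (by filter_upwards [hball ε hε] with y hy using hWd y hy s (hIcc hs)) ?_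
        have : Tendsto (fun y ↦ K * dist y z) (𝓝 z) (𝓝 (K * dist z z)) :=
          (by fun_prop : Continuous fun y ↦ K * dist y z).tendsto z
        simpa using this
      have hne := LoewnerSol.ne hw (hIcc hs)
      exact ((tendsto_const_nhds (x := 2 * driveReal ξ s ^ 2)).div
        ((tendsto_const_nhds.sub h1).mul tendsto_const_nhds) (mul_ne_zero hne hne)).const_add (-1)
  refine HasDerivAt.differentiableAt (f' := Complex.exp E₀) (hasDerivAt_iff_tendsto_slope.2 ?_)
  refine ((Complex.continuous_exp.tendsto _).comp (hlim.mono_left nhdsWithin_le_nhds)).congr' ?_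
  filter_upwards [mem_nhdsWithin_of_mem_nhds (hball ε hε), self_mem_nhdsWithin] with y hy hyz
  rw [slope_def_field, (hsol y hy).loewnerMap_eq hξ, hw.loewnerMap_eq hξ,
    (hsol y hy).sub_eq hξ hw t.coe_nonneg, mul_div_cancel_left₀ _ (sub_ne_zero.2 hyz)]
  rfl

end Loewner

/-! ### Swallowing times and the trace -/

section Swallowing

variable {ξ : ℝ≥0 → ℝ} {z : ℂ}

/-- A solution which ends away from the driving point was away from it shortly before. -/
lemma exists_forall_le_norm_of_end (hξ : Continuous ξ) (T : ℝ) {c : ℝ} (hc : 0 < c) :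
    ∃ η > 0, ∀ z w, ‖z‖ < 1 → LoewnerSol ξ z T w → 2 * c ≤ ‖w T - driveReal ξ T‖ →
      ∀ t ∈ Icc 0 T, T - η ≤ t → c ≤ ‖w t - driveReal ξ t‖ := by
  obtain ⟨η, hη, hηT⟩ := Metric.continuous_iff.1 (continuous_driveReal hξ) T (c / 4) (by linarith)
  -- At distance at least `c` the speed is at most `2 / c`, so in time `c ^ 2 / 8` the solution
  -- moves at most `c / 4`; the driving point moves less than `c / 4`. Growth from `c` to `2 * c` is
  -- thus impossible.
  refine ⟨min (η / 2) (c ^ 2 / 8), by positivity, fun z w hz hw hwT t ht htη ↦ ?_⟩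
  by_contra! hlt
  have hT : 0 ≤ T := ht.1.trans ht.2
  set B : Set ℝ := {s | s ∈ Icc t T ∧ ‖w s - driveReal ξ s‖ ≤ c} with hB
  have hcont : ContinuousOn (fun s ↦ ‖w s - driveReal ξ s‖) (Icc t T) :=
    ((hw.continuousOn.mono (Icc_subset_Icc_left ht.1)).sub
      (continuous_driveReal hξ).continuousOn).norm
  have hBc : IsClosed B := by
    have : B = Icc t T ∩ (fun s ↦ ‖w s - driveReal ξ s‖) ⁻¹' Iic c := by ext; simp [hB]
    rw [this]
    exact hcont.preimage_isClosed_of_isClosed isClosed_Icc isClosed_Iic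
  have hBb : BddAbove B := ⟨T, fun s hs ↦ hs.1.2⟩
  have hs₀ : sSup B ∈ B := hBc.csSup_mem ⟨t, ⟨le_rfl, ht.2⟩, hlt.le⟩ hBb
  set s₀ := sSup B
  have h0 : 0 ≤ s₀ := ht.1.trans hs₀.1.1
  -- `s₀` is the last time at distance at most `c`; at `s₀` itself the lower bound follows by
  -- continuity from the right.
  have hbound (s) (hs : s ∈ Icc s₀ T) : c ≤ ‖driveReal ξ s - w s‖ := by
    rw [norm_sub_rev]
    rcases hs.1.eq_or_lt with rfl | hlt'
    · by_contra! hlt2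
      have hs₀T : s₀ < T := by
        refine hs₀.1.2.lt_of_ne fun h ↦ ?_
        rw [h] at hlt2
        linarith
      have hnebot : (𝓝[Ioc s₀ T] s₀).NeBot := by
        rw [nhdsWithin_Ioc_eq_nhdsGT hs₀T]
        infer_instance
      have hev : ∀ᶠ r in 𝓝[Icc s₀ T] s₀, ‖w r - driveReal ξ r‖ < c :=
        ((hcont.mono (Icc_subset_Icc_left hs₀.1.1)) s₀
          (left_mem_Icc.2 hs₀.1.2)).eventually_lt continuousWithinAt_const hlt2
      obtain ⟨r, hr, hrT⟩ := ((hev.filter_mono (nhdsWithin_mono s₀ Ioc_subset_Icc_self)).and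
        eventually_mem_nhdsWithin).exists
      exact absurd (le_csSup hBb ⟨⟨hs₀.1.1.trans hrT.1.le, hrT.2⟩, hr.le⟩) hrT.1.not_ge
    · by_contra! hlt2
      exact absurd (le_csSup hBb ⟨⟨hs₀.1.1.trans hs.1, hs.2⟩, hlt2.le⟩) hlt'.not_ge
  have hmv := Convex.norm_image_sub_le_of_norm_hasDerivWithin_le (f := w) (C := 2 / c)
    (s := Icc s₀ T) (x := s₀) (y := T)
    (fun s hs ↦ (hw.2 s ⟨h0.trans hs.1, hs.2⟩).2.mono (Icc_subset_Icc_left h0))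
    (fun s hs ↦ by
      have h1 := (LoewnerSol.norm_lt_one hξ hz hw s ⟨h0.trans hs.1, hs.2⟩).le
      have h2 : ‖driveReal ξ s + w s‖ ≤ 2 := by
        have := norm_add_le (driveReal ξ s) (w s)
        rw [norm_driveReal] at this
        linarith
      rw [loewnerField, norm_mul, norm_div]
      calc ‖w s‖ * (‖driveReal ξ s + w s‖ / ‖driveReal ξ s - w s‖) ≤ 1 * (2 / c) := by
            gcongr
            exact hbound s hs
        _ = 2 / c := one_mul _)
    (convex_Icc _ _) (left_mem_Icc.2 hs₀.1.2) (right_mem_Icc.2 hs₀.1.2)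
  have hTs : T - s₀ ≤ c ^ 2 / 8 := by
    linarith [hs₀.1.1, min_le_right (η / 2) (c ^ 2 / 8)]
  rw [Real.norm_of_nonneg (sub_nonneg.2 hs₀.1.2)] at hmv
  have hmv' : ‖w T - w s₀‖ ≤ c / 4 := by
    refine hmv.trans ?_
    calc 2 / c * (T - s₀) ≤ 2 / c * (c ^ 2 / 8) := by gcongr
      _ = c / 4 := by field_simp; norm_num
  have hd := hηT s₀ (by
    rw [Real.dist_eq, abs_lt]
    constructor <;> linarith [hs₀.1.1, hs₀.1.2, min_le_left (η / 2) (c ^ 2 / 8)])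
  rw [dist_eq_norm] at hd
  have h3 : w T - driveReal ξ T = (w T - w s₀) + (w s₀ - driveReal ξ s₀) +
    (driveReal ξ s₀ - driveReal ξ T) := by ring
  have h4 := norm_add₃_le (a := w T - w s₀) (b := w s₀ - driveReal ξ s₀)
    (c := driveReal ξ s₀ - driveReal ξ T)
  rw [← h3] at h4
  linarith [hs₀.2]

lemma isCompact_loewner_tube (c : ℝ) :
    IsCompact {p : ℂ × ℂ | ‖p.1‖ ≤ 1 ∧ ‖p.2‖ ≤ 1 ∧ c ≤ ‖p.2 - p.1‖} := by
  have h1 : {p : ℂ × ℂ | ‖p.1‖ ≤ 1 ∧ ‖p.2‖ ≤ 1 ∧ c ≤ ‖p.2 - p.1‖} =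
      (Metric.closedBall 0 1 ×ˢ Metric.closedBall 0 1) ∩ {p | c ≤ ‖p.2 - p.1‖} := by
    ext p
    simp [and_assoc]
  rw [h1]
  exact ((isCompact_closedBall 0 1).prod (isCompact_closedBall 0 1)).inter_right
    (isClosed_le (by fun_prop) (by fun_prop))

/-- At the time `T` at which `z` is swallowed, `g_T` tends to the driving point at `z`. -/
theorem tendsto_loewnerMap_of_swallowed (hξ : Continuous ξ) {T : ℝ≥0}
    (hlt : ∀ t < T, z ∈ loewnerDomain ξ t) (hz : z ∉ loewnerDomain ξ T) (hz1 : ‖z‖ < 1) :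
    Tendsto (loewnerMap ξ T) (𝓝[loewnerDomain ξ T] z) (𝓝 (drivePoint ξ T)) := by
  have hT : (0 : ℝ) < T := by
    refine T.coe_nonneg.lt_of_ne fun h ↦ hz ?_
    rw [show T = 0 from NNReal.coe_injective h.symm, loewnerDomain_zero]
    simpa using hz1
  have hltR (t : ℝ) (ht : t ∈ Ico 0 (T : ℝ)) : ∃ w, LoewnerSol ξ z t w := by
    simpa [ht.1] using (mem_loewnerDomain.1 (hlt t.toNNReal
      ((Real.toNNReal_lt_iff_lt_coe ht.1).2 ht.2))).2
  by_contra hcon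
  obtain ⟨ρ, hρ, hfreq⟩ : ∃ ρ > 0, ∃ᶠ y in 𝓝[loewnerDomain ξ T] z,
      ρ ≤ dist (loewnerMap ξ T y) (drivePoint ξ T) := by
    rw [Metric.tendsto_nhds] at hcon
    push Not at hcon
    obtain ⟨ρ, hρ, h⟩ := hcon
    exact ⟨ρ, hρ, h.mono fun y hy ↦ by simpa using hy⟩
  obtain ⟨η, hη, hback⟩ := exists_forall_le_norm_of_end hξ T (half_pos hρ)
  -- Here `η` does not depend on the nearby point `y`. If the solution from `z` came too close at
  -- time `t`, so would that from some `y` in `D_T` ending at distance at least `ρ`.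
  have hlate (t : ℝ) (ht : t ∈ Ico 0 (T : ℝ)) (htη : T - η ≤ t) (w) (hw : LoewnerSol ξ z t w) :
      ρ / 2 ≤ ‖w t - driveReal ξ t‖ := by
    by_contra! hsmall
    obtain ⟨ε, hε, K, hK, hst⟩ := LoewnerSol.stable hξ ht.1 hw
    have hnear : ∀ᶠ y in 𝓝[loewnerDomain ξ T] z, dist y z < ε ∧
        dist y z < (ρ / 2 - ‖w t - driveReal ξ t‖) / K :=
      mem_nhdsWithin_of_mem_nhds (Filter.inter_mem (Metric.ball_mem_nhds z hε)
        (Metric.ball_mem_nhds z (div_pos (by linarith) hK)))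
    obtain ⟨y, hyρ, hy, hyD⟩ := (hfreq.and_eventually
      (hnear.and eventually_mem_nhdsWithin)).exists
    obtain ⟨hy1, v, hv⟩ := mem_loewnerDomain.1 hyD
    obtain ⟨w', hw', hd⟩ := hst y hy.1
    have hvt : v t = w' t := IsSolution.eqOn locallyLipschitzOn_loewnerField
      (continuous_driveReal hξ) (hv.mono ht.2.le) (hw'.mono (by linarith)) (right_mem_Icc.2 ht.1)
    rw [hv.loewnerMap_eq hξ, dist_eq_norm] at hyρ
    have h1 := hback y v hy1 hv (by
      have : driveReal ξ T = drivePoint ξ T := by simp [driveReal]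
      rw [this]
      linarith) t ⟨ht.1, ht.2.le⟩ htη
    have h2 := hd t (right_mem_Icc.2 ht.1)
    have h3 := (lt_div_iff₀ hK).1 hy.2
    rw [hvt] at h1
    rw [dist_eq_norm] at h2
    have h4 := norm_add_le (w' t - w t) (w t - driveReal ξ t)
    rw [sub_add_sub_cancel] at h4
    linarith
  set t₁ : ℝ := max 0 (T - η)
  have ht₁ : t₁ ∈ Ico 0 (T : ℝ) := ⟨le_max_left _ _, max_lt hT (by linarith)⟩
  obtain ⟨w₁, hw₁⟩ := hltR t₁ ht₁
  obtain ⟨c, hc, hcw⟩ := LoewnerSol.exists_le_norm hξ hw₁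
  have hc' : 0 < min c (ρ / 2) := lt_min hc (half_pos hρ)
  -- The solution from `z` now stays in a compact tube on `[0, T)`, so it survives to time `T`: a
  -- contradiction.
  refine hz (mem_loewnerDomain.2 ⟨hz1, exists_isSolution_of_forall_lt
    locallyLipschitzOn_loewnerField (continuous_driveReal hξ) hT
    (isCompact_loewner_tube (min c (ρ / 2))) ?_ fun t ht ↦ ?_⟩)
  · rintro p ⟨-, -, hp⟩ heq
    rw [heq, sub_self, norm_zero] at hp
    linarith
  · obtain ⟨w, hw⟩ := hltR t ht
    refine ⟨w, hw, fun s hs ↦ ⟨(norm_driveReal ξ s).le,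
      (LoewnerSol.norm_lt_one hξ hz1 hw s hs).le, ?_⟩⟩
    rcases le_total s t₁ with h | h
    · have : w s = w₁ s := IsSolution.eqOn locallyLipschitzOn_loewnerField
        (continuous_driveReal hξ) (hw.mono hs.2) (hw₁.mono h) (right_mem_Icc.2 hs.1)
      simp only [this]
      rw [norm_sub_rev]
      exact (min_le_left _ _).trans (hcw s ⟨hs.1, h⟩)
    · exact (min_le_right _ _).trans (hlate s ⟨hs.1, hs.2.trans_lt ht.2⟩
        ((le_max_right _ _).trans h) w (hw.mono hs.2))

/-- Compact connected sets which contain `0` and avoid the trace are not swallowed. -/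
theorem subset_loewnerDomain (hξ : Continuous ξ) {β : ℝ≥0 → ℂ} (hβ : IsLoewnerCurve ξ β)
    {K : Set ℂ} (hK : IsCompact K) (hKc : IsPreconnected K) (h0 : (0 : ℂ) ∈ K)
    (hK1 : K ⊆ Metric.ball 0 1) {t : ℝ≥0} (hd : Disjoint K (β '' Icc 0 t)) :
    K ⊆ loewnerDomain ξ t := by
  by_contra hcon
  set A : Set ℝ≥0 := {s | ¬ K ⊆ loewnerDomain ξ s}
  have hA : A.Nonempty := ⟨t, hcon⟩
  set T := sInf A
  have hTt : T ≤ t := csInf_le (OrderBot.bddBelow A) hcon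
  have hlt (s) (hs : s < T) : K ⊆ loewnerDomain ξ s := by
    by_contra h
    exact absurd (csInf_le (OrderBot.bddBelow A) h) hs.not_ge
  -- Solvability is open in time and starting point, so compactness would carry `K` past `T`.
  have hT : ¬ K ⊆ loewnerDomain ξ T := fun hsub ↦ by
    obtain ⟨ε, hε, hεK⟩ : ∃ ε > 0, ∀ s : ℝ≥0, (s : ℝ) ≤ T + ε → K ⊆ loewnerDomain ξ s := by
      refine hK.induction_on (p := fun K ↦ ∃ ε > (0 : ℝ), ∀ s : ℝ≥0, (s : ℝ) ≤ T + ε →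
        K ⊆ loewnerDomain ξ s) ⟨1, one_pos, by simp⟩
        (fun s u hsu ⟨ε, hε, h⟩ ↦ ⟨ε, hε, fun r hr ↦ hsu.trans (h r hr)⟩)
        (fun s u ⟨ε, hε, h⟩ ⟨ε', hε', h'⟩ ↦ ⟨min ε ε', lt_min hε hε', fun r hr ↦ union_subset
          (h r (hr.trans (by gcongr; exact min_le_left _ _)))
          (h' r (hr.trans (by gcongr; exact min_le_right _ _)))⟩) fun z hz ↦ ?_
      obtain ⟨ε, hε, h⟩ := exists_ball_subset_loewnerDomain hξ (hsub hz)
      exact ⟨_, mem_nhdsWithin_of_mem_nhds (Metric.ball_mem_nhds z hε), ε, hε, h⟩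
    obtain ⟨s, hs, hsT⟩ := exists_lt_of_csInf_lt hA
      (show T < T + ε.toNNReal from lt_add_of_pos_right _ (Real.toNNReal_pos.2 hε))
    refine hs (hεK s ?_)
    have := NNReal.coe_le_coe.2 hsT.le
    rwa [NNReal.coe_add, Real.coe_toNNReal _ hε.le] at this
  obtain ⟨z, ⟨hzcl, hzK⟩, hzT⟩ : ∃ z ∈ closure (loewnerDomain ξ T) ∩ K, z ∉ loewnerDomain ξ T := by
    by_contra! h
    exact hT (hKc.subset_of_closure_inter_subset (isOpen_loewnerDomain hξ T)
      ⟨0, h0, zero_mem_loewnerDomain ξ T⟩ h)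
  have hz1 : ‖z‖ < 1 := mem_ball_zero_iff.1 (hK1 hzK)
  have hlim := tendsto_loewnerMap_of_swallowed hξ (fun s hs ↦ hlt s hs hzK) hzT hz1
  have hlim' : Tendsto (loewnerMap ξ T) (𝓝[loewnerDomain ξ T] z)
      (𝓝[Metric.ball 0 1] (drivePoint ξ T)) :=
    tendsto_nhdsWithin_iff.2 ⟨hlim, eventually_mem_nhdsWithin.mono fun y hy ↦
      mem_ball_zero_iff.2 (norm_loewnerMap_lt_one hξ hy)⟩
  have : (𝓝[loewnerDomain ξ T] z).NeBot := mem_closure_iff_nhdsWithin_neBot.1 hzcl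
  -- The inverse map applied to `g_T y` returns `y`, so the limit defining `β T` is computed along
  -- `y → z`.
  have hβz : Tendsto (fun y ↦ y) (𝓝[loewnerDomain ξ T] z) (𝓝 (β T)) := by
    refine ((hβ.2 T).comp hlim').congr' (eventually_mem_nhdsWithin.mono fun y hy ↦ ?_)
    exact (injOn_loewnerMap hξ T).leftInvOn_invFunOn hy
  have heq : z = β T := tendsto_nhds_unique (tendsto_id.mono_left nhdsWithin_le_nhds) hβz
  exact disjoint_left.1 hd hzK ⟨T, ⟨zero_le, hTt⟩, heq.symm⟩

/-- As `g_0` is the identity, the limit defining `β 0` is the driving point. -/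
lemma norm_trace_zero (hξ : Continuous ξ) {β : ℝ≥0 → ℂ} (hβ : IsLoewnerCurve ξ β) :
    ‖β 0‖ = 1 := by
  have hmem : drivePoint ξ 0 ∈ closure (Metric.ball (0 : ℂ) 1) := by
    rw [closure_ball _ one_ne_zero, mem_closedBall_zero_iff, norm_drivePoint]
  have : (𝓝[Metric.ball 0 1] (drivePoint ξ 0)).NeBot := mem_closure_iff_nhdsWithin_neBot.1 hmem
  have h : Tendsto (fun y ↦ y) (𝓝[Metric.ball 0 1] (drivePoint ξ 0)) (𝓝 (β 0)) := by
    refine (hβ.2 0).congr' (eventually_mem_nhdsWithin.mono fun y hy ↦ ?_)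
    have hy' : y ∈ loewnerDomain ξ 0 := by rwa [loewnerDomain_zero]
    have := (injOn_loewnerMap hξ 0).leftInvOn_invFunOn hy'
    rwa [loewnerMap_zero_left hξ (mem_ball_zero_iff.1 hy)] at this
  rw [← tendsto_nhds_unique (tendsto_id.mono_left nhdsWithin_le_nhds) h, norm_drivePoint]

lemma one_sub_ne_zero_of_norm_lt_one {u : ℂ} (hu : ‖u‖ < 1) : 1 - u ≠ 0 := by
  rw [sub_ne_zero]
  rintro rfl
  simp at hu

lemma re_cayley_pos {u : ℂ} (hu : ‖u‖ < 1) : 0 < ((1 + u) / (1 - u)).re := by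
  have h1 : 0 < Complex.normSq (1 - u) :=
    Complex.normSq_pos.2 (one_sub_ne_zero_of_norm_lt_one hu)
  have h2 : Complex.normSq u < 1 := by
    rw [Complex.normSq_eq_norm_sq]
    nlinarith [norm_nonneg u]
  simp only [Complex.div_re, ← add_div]
  refine div_pos ?_ h1
  simp only [Complex.add_re, Complex.one_re, Complex.sub_re, Complex.add_im, Complex.one_im,
    Complex.sub_im]
  rw [Complex.normSq_apply] at h2
  nlinarith

/-- `Q_t` is the real part of a holomorphic function. -/
theorem exists_isCaratheodory_loewnerPoisson (hξ : Continuous ξ) {t : ℝ≥0} {V : Set ℂ}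
    (hV : V ⊆ loewnerDomain ξ t) :
    ∃ h, IsCaratheodory V h ∧ ∀ z, loewnerPoisson ξ t z = (h z).re := by
  have hρ : ‖drivePoint ξ t‖ = 1 := norm_drivePoint ξ t
  have hlt (z) (hz : z ∈ V) : ‖loewnerMap ξ t z / drivePoint ξ t‖ < 1 := by
    rw [norm_div, hρ, div_one]
    exact norm_loewnerMap_lt_one hξ (hV hz)
  refine ⟨fun z ↦ (1 + loewnerMap ξ t z / drivePoint ξ t) / (1 - loewnerMap ξ t z / drivePoint ξ t),
    ⟨?_, fun z hz ↦ ?_, by simp [loewnerMap_zero_right hξ]⟩, fun z ↦ rfl⟩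
  · have hg : DifferentiableOn ℂ (loewnerMap ξ t) V := fun z hz ↦
      (differentiableAt_loewnerMap hξ (hV hz)).differentiableWithinAt
    exact ((hg.div_const _).const_add 1).div ((hg.div_const _).const_sub 1)
      fun z hz ↦ one_sub_ne_zero_of_norm_lt_one (hlt z hz)
  · exact re_cayley_pos (hlt z hz)

end Swallowing

/-! ### The conditioned path -/

section Drift

lemma diskPoisson_one_pos {z : ℂ} (hz : z ∈ Metric.ball (0 : ℂ) 1) : 0 < diskPoisson 1 z := by
  rw [diskPoisson, div_one]
  exact re_cayley_pos (mem_ball_zero_iff.1 hz)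

lemma contDiffOn_diskPoisson_one : ContDiffOn ℝ 2 (diskPoisson 1) (Metric.ball 0 1) := by
  refine ContDiffOn.congr (f := fun z : ℂ ↦ Complex.reCLM ((1 + z) * (1 - z)⁻¹)) ?_ fun z _ ↦ by
    simp [diskPoisson, div_eq_mul_inv]
  refine Complex.reCLM.contDiff.comp_contDiffOn ((contDiff_const.add contDiff_id).contDiffOn.mul
    ((contDiff_const.sub contDiff_id).contDiffOn.inv fun z hz ↦ ?_))
  exact one_sub_ne_zero_of_norm_lt_one (mem_ball_zero_iff.1 hz)

noncomputable def driftField (p : ℂ × ℂ) : ℂ :=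
  twoDbar (diskPoisson 1) (p.2 + p.1) / (diskPoisson 1 (p.2 + p.1) : ℂ)

def driftRegion : Set (ℂ × ℂ) := {p | p.2 + p.1 ∈ Metric.ball (0 : ℂ) 1}

lemma isOpen_driftRegion : IsOpen driftRegion :=
  Metric.isOpen_ball.preimage (continuous_snd.add continuous_fst)

lemma locallyLipschitzOn_driftField : LocallyLipschitzOn driftRegion driftField := by
  refine isOpen_driftRegion.locallyLipschitzOn_of_contDiffOn ?_
  have hP := contDiffOn_diskPoisson_one
  have hf : ContDiffOn ℝ 1 (fderiv ℝ (diskPoisson 1)) (Metric.ball 0 1) :=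
    hP.fderiv_of_isOpen Metric.isOpen_ball (by norm_num)
  have hof {g : ℂ → ℝ} (hg : ContDiffOn ℝ 1 g (Metric.ball 0 1)) :
      ContDiffOn ℝ 1 (fun z ↦ (g z : ℂ)) (Metric.ball 0 1) :=
    Complex.ofRealCLM.contDiff.comp_contDiffOn hg
  have hG : ContDiffOn ℝ 1 (fun z ↦ twoDbar (diskPoisson 1) z * (diskPoisson 1 z : ℂ)⁻¹)
      (Metric.ball 0 1) :=
    ((hof (hf.clm_apply contDiffOn_const)).add
      (contDiffOn_const.mul (hof (hf.clm_apply contDiffOn_const)))).mul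
      ((hof (hP.of_le (by norm_num))).inv fun z hz ↦
        Complex.ofReal_ne_zero.2 (diskPoisson_one_pos hz).ne')
  exact hG.comp (contDiff_snd.add contDiff_fst).contDiffOn fun p hp ↦ hp

variable {b : ℝ≥0 → ℂ}

abbrev DriftSol (b : ℝ≥0 → ℂ) (T : ℝ) (δ : ℝ → ℂ) : Prop :=
  IsSolution driftField driftRegion (fun t ↦ b t.toNNReal) 0 T δ

lemma isDriftSolution_iff {T : ℝ≥0} {δ : ℝ → ℂ} : IsDriftSolution 1 b T δ ↔ DriftSol b T δ :=
  Iff.rfl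

lemma DriftSol.drift_eq (hb : Continuous b) {t : ℝ≥0} {δ : ℝ → ℂ} (h : DriftSol b t δ) :
    drift 1 b t = δ t := by
  have hex : ∃ δ : ℝ → ℂ, IsDriftSolution 1 b t δ := ⟨δ, h⟩
  rw [drift, dif_pos hex]
  exact IsSolution.eqOn locallyLipschitzOn_driftField (hb.comp continuous_real_toNNReal)
    hex.choose_spec h (right_mem_Icc.2 t.coe_nonneg)

/-- A solution on `[0, t]` continues a little past `t`, so the supremum is strictly larger. -/
lemma DriftSol.lt_lifetime (hb : Continuous b) {t : ℝ≥0} {δ : ℝ → ℂ} (h : DriftSol b t δ) :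
    (t : ℝ≥0∞) < lifetime 1 b := by
  obtain ⟨ε, hε, K, -, hst⟩ := IsSolution.stable isOpen_driftRegion locallyLipschitzOn_driftField
    (hb.comp continuous_real_toNNReal) t.coe_nonneg h
  obtain ⟨δ', hδ', -⟩ := hst 0 (by simpa using hε)
  have hlt : t < t + ε.toNNReal := lt_add_of_pos_right _ (Real.toNNReal_pos.2 hε)
  refine (ENNReal.coe_lt_coe.2 hlt).trans_le (le_iSup₂_of_le _ ⟨δ', ?_⟩ le_rfl)
  rw [isDriftSolution_iff, NNReal.coe_add, Real.coe_toNNReal _ hε.le]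
  exact hδ'

lemma isCompact_drift_tube {K : Set ℂ} (hK : IsCompact K) (R : ℝ) :
    IsCompact {p : ℂ × ℂ | p.1 ∈ Metric.closedBall 0 R ∧ p.2 + p.1 ∈ K} := by
  have : {p : ℂ × ℂ | p.1 ∈ Metric.closedBall 0 R ∧ p.2 + p.1 ∈ K} =
      (fun q : ℂ × ℂ ↦ (q.1, q.2 - q.1)) '' (Metric.closedBall 0 R ×ˢ K) := by
    ext ⟨x, y⟩
    constructor
    · rintro ⟨h1, h2⟩
      exact ⟨(x, y + x), ⟨h1, h2⟩, by simp⟩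
    · rintro ⟨⟨u, v⟩, ⟨h1, h2⟩, h⟩
      obtain ⟨rfl, rfl⟩ := Prod.mk.injEq _ _ _ _ ▸ h
      exact ⟨h1, by simpa using h2⟩
  rw [this]
  exact ((isCompact_closedBall 0 R).prod hK).image (by fun_prop)

/-- Up to the time when it hits `σ`, the conditioned path stays in the closure of the component of
`0`, and this time comes before the end of its life. -/
theorem conditioned_mem_closure (hb : Continuous b) (hb0 : b 0 = 0) {σ : Set ℂ}
    (hσ : IsClosed σ) (h0 : (0 : ℂ) ∉ σ)
    (hball : closure (connectedComponentIn σᶜ 0) ⊆ Metric.ball 0 1) {t₁ : ℝ≥0}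
    (ht₁ : (t₁ : ℝ≥0∞) ≤ hitTime (conditioned 1 b) (lifetime 1 b) σ) :
    (t₁ : ℝ≥0∞) < lifetime 1 b ∧
      ∀ t ∈ Icc 0 t₁, conditioned 1 b t ∈ closure (connectedComponentIn σᶜ 0) := by
  set a : ℝ → ℂ := fun t ↦ b t.toNNReal
  have ha : Continuous a := hb.comp continuous_real_toNNReal
  have hK : IsCompact (closure (connectedComponentIn σᶜ (0 : ℂ))) :=
    Metric.isCompact_of_isClosed_isBounded isClosed_closure (Metric.isBounded_ball.subset hball)
  obtain ⟨R, hR⟩ := isCompact_Icc.exists_bound_of_continuousOn (ha.continuousOn (s := Icc 0 (t₁ : ℝ)))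
  -- The cut-off flow gives a comparison path on all of `[0, t₁]` before the true drift is known to
  -- live that long.
  obtain ⟨Φ, -, -, hΦ₀, hΦc, -, hΦs, -⟩ := exists_flow locallyLipschitzOn_driftField ha
    (isCompact_drift_tube hK R) (fun p hp ↦ hball hp.2) t₁.coe_nonneg
  have hYc : ContinuousOn (fun t ↦ Φ 0 t + a t) (Icc 0 (t₁ : ℝ)) := (hΦc 0).add ha.continuousOn
  have hY0 : Φ 0 0 + a 0 = 0 := by simp [hΦ₀, a, hb0]
  have hU0 : (0 : ℂ) ∈ connectedComponentIn σᶜ 0 := mem_connectedComponentIn h0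
  -- While the comparison path avoids `σ` it stays in the tube, where it is the true path; time `s`
  -- is included by closure.
  have step (s : ℝ≥0) (hs : s ≤ t₁) (hav : ∀ r ∈ Ico 0 (s : ℝ), Φ 0 r + a r ∉ σ) :
      (s : ℝ≥0∞) < lifetime 1 b ∧ ∀ r : ℝ≥0, r ≤ s → conditioned 1 b r = Φ 0 r + a r ∧
        conditioned 1 b r ∈ closure (connectedComponentIn σᶜ 0) := by
    have hsR : (s : ℝ) ≤ t₁ := NNReal.coe_le_coe.2 hs
    have hcl (r : ℝ) (hr : r ∈ Icc 0 (s : ℝ)) :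
        Φ 0 r + a r ∈ closure (connectedComponentIn σᶜ 0) := by
      rcases s.coe_nonneg.eq_or_lt with hs0 | hs0
      · obtain rfl : r = 0 := le_antisymm (hs0 ▸ hr.2) hr.1
        rw [hY0]
        exact subset_closure hU0
      · have hYs := hYc.mono (Icc_subset_Icc_right hsR)
        have himg : (fun t ↦ Φ 0 t + a t) '' Ico 0 (s : ℝ) ⊆ connectedComponentIn σᶜ 0 := by
          refine IsPreconnected.subset_connectedComponentIn
            (isPreconnected_Ico.image _ (hYs.mono Ico_subset_Icc_self))
            ⟨0, left_mem_Ico.2 hs0, hY0⟩ ?_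
          rintro _ ⟨r, hr, rfl⟩
          exact hav r hr
        rw [← closure_Ico hs0.ne] at hYs hr
        exact closure_mono himg (hYs.image_closure (mem_image_of_mem _ hr))
    have hsol : DriftSol b s (Φ 0) := hΦs 0 s hsR fun r hr ↦
      ⟨mem_closedBall_zero_iff.2 (hR r ⟨hr.1, hr.2.trans hsR⟩), hcl r hr⟩
    refine ⟨hsol.lt_lifetime hb, fun r hr ↦ ?_⟩
    have hrs : (r : ℝ) ≤ s := NNReal.coe_le_coe.2 hr
    have heq : conditioned 1 b r = Φ 0 r + a r := by
      rw [conditioned, DriftSol.drift_eq hb (hsol.mono hrs), add_comm]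
      simp [a]
    exact ⟨heq, heq ▸ hcl r ⟨r.coe_nonneg, hrs⟩⟩
  -- Up to its first hit of `σ` the comparison path is the true one, so a hit before `t₁`
  -- contradicts `ht₁`.
  have havoid : ∀ r ∈ Ico 0 (t₁ : ℝ), Φ 0 r + a r ∉ σ := by
    by_contra! h
    obtain ⟨r, hr, hrσ⟩ := h
    set B : Set ℝ := Icc 0 (t₁ : ℝ) ∩ (fun t ↦ Φ 0 t + a t) ⁻¹' σ
    have hBb : BddBelow B := ⟨0, fun s hs ↦ hs.1.1⟩
    have hrB : r ∈ B := ⟨Ico_subset_Icc_self hr, hrσ⟩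
    have hmem : sInf B ∈ B :=
      (hYc.preimage_isClosed_of_isClosed isClosed_Icc hσ).csInf_mem ⟨r, hrB⟩ hBb
    lift sInf B to ℝ≥0 using hmem.1.1 with m hm
    have hmt : m < t₁ := NNReal.coe_lt_coe.1 (hm ▸ (csInf_le hBb hrB).trans_lt hr.2)
    obtain ⟨hlt, heq⟩ := step m hmt.le fun s hs hsσ ↦ by
      have := csInf_le hBb (show s ∈ B from
        ⟨⟨hs.1, hs.2.le.trans (NNReal.coe_le_coe.2 hmt.le)⟩, hsσ⟩)
      rw [← hm] at this
      exact this.not_gt hs.2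
    have hX : conditioned 1 b m ∈ σ := by
      rw [(heq m le_rfl).1]
      exact hmem.2
    have : (t₁ : ℝ≥0∞) ≤ m := ht₁.trans (iInf₂_le m ⟨hlt, hX⟩)
    exact (ENNReal.coe_le_coe.1 this).not_gt hmt
  obtain ⟨h1, h2⟩ := step t₁ le_rfl havoid
  exact ⟨h1, fun t ht ↦ (h2 t ht.2).2⟩

end Drift

/-! ### Components of complements of curves -/

section Planar

lemma not_isBounded_of_ray {σ V : Set ℂ} {x z : ℂ} (hx : x ≠ 0)
    (hray : ∀ s : ℝ, 1 ≤ s → (s : ℂ) * x ∉ σ) (hV : V = connectedComponentIn σᶜ z)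
    (hxV : x ∈ V) : ¬ Bornology.IsBounded V := by
  intro hb
  have hsub : (fun s : ℝ ↦ (s : ℂ) * x) '' Ici 1 ⊆ V := by
    rw [hV, connectedComponentIn_eq (hV ▸ hxV)]
    refine IsPreconnected.subset_connectedComponentIn
      (isPreconnected_Ici.image _ (by fun_prop)) ⟨1, self_mem_Ici, by simp⟩ ?_
    rintro _ ⟨s, hs, rfl⟩
    exact hray s hs
  obtain ⟨R, hR⟩ := hb.exists_norm_le
  have h := hR _ (hsub (mem_image_of_mem _ (mem_Ici.2 (le_max_left 1 ((R + 1) / ‖x‖)))))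
  rw [norm_mul, Complex.norm_real, Real.norm_of_nonneg (by positivity)] at h
  have h2 : (R + 1) / ‖x‖ * ‖x‖ ≤ max 1 ((R + 1) / ‖x‖) * ‖x‖ := by
    gcongr
    exact le_max_right _ _
  rw [div_mul_cancel₀ _ (norm_ne_zero_iff.2 hx)] at h2
  linarith

/-- From a point outside the disc the outward ray misses `σ`, which would make the component
unbounded. -/
lemma connectedComponentIn_subset_ball {σ : Set ℂ} {z : ℂ} (hσ : σ ⊆ Metric.ball 0 1)
    (hb : Bornology.IsBounded (connectedComponentIn σᶜ z)) :
    connectedComponentIn σᶜ z ⊆ Metric.ball 0 1 := by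
  intro x hx
  by_contra hx1
  rw [mem_ball_zero_iff, not_lt] at hx1
  refine not_isBounded_of_ray (norm_pos_iff.1 (one_pos.trans_le hx1)) (fun s hs hmem ↦ ?_) rfl hx hb
  have := mem_ball_zero_iff.1 (hσ hmem)
  rw [norm_mul, Complex.norm_real, Real.norm_of_nonneg (by linarith)] at this
  nlinarith

lemma closure_connectedComponentIn_inter_subset {F : Set ℂ} {z : ℂ} (hz : z ∈ F) :
    closure (connectedComponentIn F z) ∩ F ⊆ connectedComponentIn F z := by
  rintro x ⟨hx, hxF⟩
  have h : IsPreconnected (insert x (connectedComponentIn F z)) :=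
    isPreconnected_connectedComponentIn.subset_closure (subset_insert _ _)
      (insert_subset hx subset_closure)
  exact h.subset_connectedComponentIn (mem_insert_of_mem _ (mem_connectedComponentIn hz))
    (insert_subset hxF (connectedComponentIn_subset F z)) (mem_insert _ _)

lemma IsJordanCurve.isCompact {σ : Set ℂ} (h : IsJordanCurve σ) : IsCompact σ := by
  obtain ⟨γ, hγ, -, rfl⟩ := h
  exact isCompact_range hγ

lemma IsJordanCurve.isConnected {σ : Set ℂ} (h : IsJordanCurve σ) : IsConnected σ := by
  obtain ⟨γ, hγ, -, rfl⟩ := h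
  exact isConnected_range hγ

/-- The closed region inside the inner curve lies inside the outer curve. -/
theorem closure_subset_of_mem_jordanPairs {σ₁ σ₂ : Set ℂ} (h : (σ₁, σ₂) ∈ JordanPairs) :
    closure (connectedComponentIn σ₁ᶜ 0) ⊆ connectedComponentIn σ₂ᶜ 0 := by
  obtain ⟨⟨-, -, h₁⟩, ⟨hJ₂, hσ₂, -⟩, hd, hs⟩ := h
  simp only at h₁ hJ₂ hσ₂ hd hs
  -- Otherwise connectedness puts all of `σ₂` inside `σ₁`. The ray outward from a farthest point `m`
  -- of `σ₂` then meets `σ₁` beyond `m`, and from there it escapes to infinity off `σ₂`, so `σ₂`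
  -- does not surround that point.
  have hdisj : Disjoint σ₂ (connectedComponentIn σ₁ᶜ 0) := by
    rw [disjoint_left]
    intro p hp hpU
    have hsub : σ₂ ⊆ connectedComponentIn σ₁ᶜ 0 := by
      rw [connectedComponentIn_eq hpU]
      exact hJ₂.isConnected.isPreconnected.subset_connectedComponentIn hp
        (disjoint_right.1 hd)
    obtain ⟨m, hm, hmax⟩ := hJ₂.isCompact.exists_isMaxOn ⟨p, hp⟩ continuous_norm.continuousOn
    have hm0 : m ≠ 0 := (hσ₂ hm).2
    obtain ⟨s, hs1, hsσ⟩ : ∃ s : ℝ, 1 ≤ s ∧ (s : ℂ) * m ∈ σ₁ := by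
      by_contra! hno
      exact not_isBounded_of_ray hm0 hno rfl (hsub hm) h₁.2
    obtain ⟨hq, hqb⟩ := hs _ hsσ
    have hs1' : 1 < s := by
      refine hs1.lt_of_ne fun h ↦ hq ?_
      rw [← h]
      simpa using hm
    have hmp : 0 < ‖m‖ := norm_pos_iff.2 hm0
    refine not_isBounded_of_ray (mul_ne_zero (Complex.ofReal_ne_zero.2 (by linarith)) hm0)
      (fun r hr hmem ↦ ?_) rfl (mem_connectedComponentIn hq) hqb
    have := hmax hmem
    simp only [mem_ofPred_eq, norm_mul, Complex.norm_real] at this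
    rw [Real.norm_of_nonneg (by linarith), Real.norm_of_nonneg (by linarith)] at this
    nlinarith [mul_pos (sub_pos.2 hs1') hmp, mul_nonneg (sub_nonneg.2 hr)
      (mul_pos (one_pos.trans hs1') hmp).le]
  have hU0 : (0 : ℂ) ∈ connectedComponentIn σ₁ᶜ 0 := mem_connectedComponentIn h₁.1
  refine isPreconnected_connectedComponentIn.closure.subset_connectedComponentIn
    (subset_closure hU0) fun x hx hxσ ↦ ?_
  exact disjoint_left.1 hdisj hxσ
    (closure_connectedComponentIn_inter_subset h₁.1 ⟨hx, disjoint_right.1 hd hxσ⟩)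

/-- A path from the unit circle does not enter the region inside `σ` before it hits `σ`. -/
theorem disjoint_of_le_hitTime {σ : Set ℂ} (hc : IsClosed σ) (hσ : σ ⊆ Metric.ball 0 1)
    (hb : Bornology.IsBounded (connectedComponentIn σᶜ 0)) {β : ℝ≥0 → ℂ} (hβ : Continuous β)
    (hβ0 : ‖β 0‖ = 1) {t : ℝ≥0} (ht : (t : ℝ≥0∞) ≤ hitTime β ⊤ σ) :
    Disjoint (connectedComponentIn σᶜ 0) (β '' Icc 0 t) := by
  have h0 : β 0 ∉ connectedComponentIn σᶜ 0 := fun h ↦ by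
    have := mem_ball_zero_iff.1 (connectedComponentIn_subset_ball hσ hb h)
    linarith
  have hlt (s) (hs : s < t) : β s ∉ connectedComponentIn σᶜ 0 := fun h ↦ by
    refine h0 ?_
    rw [connectedComponentIn_eq h]
    refine IsPreconnected.subset_connectedComponentIn (isPreconnected_Icc.image β hβ.continuousOn)
      ⟨s, ⟨zero_le, le_rfl⟩, rfl⟩ ?_ ⟨0, ⟨le_rfl, zero_le⟩, rfl⟩
    rintro _ ⟨r, hr, rfl⟩ hrσ
    have : (t : ℝ≥0∞) ≤ r := ht.trans (iInf₂_le r ⟨ENNReal.coe_lt_top, hrσ⟩)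
    exact (ENNReal.coe_le_coe.1 this).not_gt (hr.2.trans_lt hs)
  rw [disjoint_right]
  rintro _ ⟨s, hs, rfl⟩ hsV
  rcases (zero_le (a := s)).eq_or_lt with rfl | hs0
  · exact h0 hsV
  -- The endpoint `s = t` may be the hitting time, so it is excluded by openness: the curve would
  -- already be inside slightly earlier.
  · have hopen : IsOpen (β ⁻¹' connectedComponentIn σᶜ 0) :=
      (hc.isOpen_compl.connectedComponentIn).preimage hβ
    obtain ⟨l, hl, hsub⟩ := exists_Ioc_subset_of_mem_nhds (hopen.mem_nhds hsV) ⟨0, hs0⟩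
    obtain ⟨r, hlr, hrs⟩ := exists_between hl
    exact hlt r (hrs.trans_le hs.2) (hsub ⟨hlr, hrs.le⟩)

/-- Each point of `V` is joined to `0` by a path in `V`, and the range of the path is compact and
connected. -/
lemma subset_loewnerDomain_of_isOpen {ξ : ℝ≥0 → ℝ} (hξ : Continuous ξ) {β : ℝ≥0 → ℂ}
    (hβ : IsLoewnerCurve ξ β) {V : Set ℂ} (hV : IsOpen V) (hVc : IsPreconnected V)
    (h0 : (0 : ℂ) ∈ V) (hV1 : V ⊆ Metric.ball 0 1) {t : ℝ≥0} (hd : Disjoint V (β '' Icc 0 t)) :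
    V ⊆ loewnerDomain ξ t := by
  intro z hz
  have hpath := (hV.isConnected_iff_isPathConnected.1 ⟨⟨0, h0⟩, hVc⟩).joinedIn 0 h0 z hz
  have hsub : range hpath.somePath ⊆ V := by
    rintro _ ⟨s, rfl⟩
    exact hpath.somePath_mem s
  exact subset_loewnerDomain hξ hβ (isCompact_range hpath.somePath.continuous)
    (isPreconnected_range hpath.somePath.continuous) ⟨0, hpath.somePath.source⟩
    (hsub.trans hV1) (hd.mono_left hsub) ⟨1, hpath.somePath.target⟩

end Planar

/-! ### The pathwise bound and its almost sure form -/

/-- The deterministic form of the main theorem. -/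
theorem exists_forall_abs_log_ratioM_le {σ₁ σ₂ : Set ℂ} (hσ : (σ₁, σ₂) ∈ JordanPairs) :
    ∃ C : ℝ, ∀ (b : ℝ≥0 → ℂ) (ξ : ℝ≥0 → ℝ) (β : ℝ≥0 → ℂ), Continuous b → b 0 = 0 →
      Continuous ξ → IsLoewnerCurve ξ β → ∀ t₁ t₂ : ℝ≥0,
        (t₁ : ℝ≥0∞) ≤ hitTime (conditioned 1 b) (lifetime 1 b) σ₁ →
        (t₂ : ℝ≥0∞) ≤ hitTime β ⊤ σ₂ →
        (t₁, t₂) ∈ disjointTimes (conditioned 1 b) (lifetime 1 b) β ∧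
        conditioned 1 b t₁ ∈ loewnerDomain ξ t₂ ∧
        0 < ratioM ξ (conditioned 1 b) t₁ t₂ ∧
        |Real.log (ratioM ξ (conditioned 1 b) t₁ t₂)| ≤ C := by
  obtain ⟨⟨hJ₁, -, h₁⟩, ⟨hJ₂, hσ₂, h₂⟩, -, -⟩ := id hσ
  simp only at hJ₁ h₁ hJ₂ hσ₂ h₂
  have hσ₂' : σ₂ ⊆ Metric.ball 0 1 := hσ₂.trans sdiff_subset
  set V := connectedComponentIn σ₂ᶜ (0 : ℂ)
  have hV : IsOpen V := hJ₂.isCompact.isClosed.isOpen_compl.connectedComponentIn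
  have hVc : IsPreconnected V := isPreconnected_connectedComponentIn
  have hV0 : (0 : ℂ) ∈ V := mem_connectedComponentIn h₂.1
  have hV1 : V ⊆ Metric.ball 0 1 := connectedComponentIn_subset_ball hσ₂' h₂.2
  have hKV := closure_subset_of_mem_jordanPairs hσ
  have hK : IsCompact (closure (connectedComponentIn σ₁ᶜ (0 : ℂ))) := h₁.2.isCompact_closure
  obtain ⟨C, hC⟩ := exists_forall_abs_log_re_le hV hVc hV0 hK hKV
  -- One `C` for `Q_{t₂}` and one for `Q_0`.
  refine ⟨C + C, fun b ξ β hb hb0 hξ hβ t₁ t₂ ht₁ ht₂ ↦ ?_⟩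
  obtain ⟨hlt, hX⟩ := conditioned_mem_closure hb hb0 hJ₁.isCompact.isClosed h₁.1 (hKV.trans hV1) ht₁
  have hdisj := disjoint_of_le_hitTime hJ₂.isCompact.isClosed hσ₂' h₂.2 hβ.1
    (norm_trace_zero hξ hβ) ht₂
  have hVD : V ⊆ loewnerDomain ξ t₂ := subset_loewnerDomain_of_isOpen hξ hβ hV hVc hV0 hV1 hdisj
  have hXt := hX t₁ (right_mem_Icc.2 zero_le)
  have hXV : conditioned 1 b t₁ ∈ V := hKV hXt
  obtain ⟨h, hh, hQ⟩ := exists_isCaratheodory_loewnerPoisson hξ hVD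
  obtain ⟨h', hh', hQ'⟩ := exists_isCaratheodory_loewnerPoisson hξ
    (hVD.trans (loewnerDomain_anti zero_le : loewnerDomain ξ t₂ ⊆ loewnerDomain ξ 0))
  have hp := hh.2.1 _ hXV
  have hp' := hh'.2.1 _ hXV
  refine ⟨⟨hlt, hdisj.mono_left ?_⟩, hVD hXV, ?_, ?_⟩
  · rintro _ ⟨t, ht, rfl⟩
    exact hKV (hX t ht)
  · rw [ratioM, hQ, hQ']
    exact div_pos hp hp'
  · rw [ratioM, hQ, hQ', Real.log_div hp.ne' hp'.ne']
    exact (abs_sub _ _).trans (add_le_add (hC h hh _ hXt) (hC h' hh' _ hXt))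

end LoopErasure

theorem mainTheorem8 (σ₁ σ₂ : Set ℂ) (hσ : (σ₁, σ₂) ∈ LoopErasure.JordanPairs) :
    ∃ C : ℝ, ∀ (Ω : Type*) [MeasurableSpace Ω] (P : MeasureTheory.Measure Ω)
      [MeasureTheory.IsProbabilityMeasure P]
      (Z : NNReal → Ω → ℂ) (B : NNReal → Ω → ℝ) (β : NNReal → Ω → ℂ),
      LoopErasure.IsComplexBrownian Z P →
      LoopErasure.IsRadialSLE 2 B β P →
      ProbabilityTheory.IndepFun (fun ω (t : NNReal) ↦ Z t ω) (fun ω (t : NNReal) ↦ B t ω) P →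
      ∀ᵐ ω ∂P,
        let ξ : NNReal → ℝ := LoopErasure.driving 2 (fun t ↦ B t ω)
        let β' : NNReal → ℂ := fun t ↦ β t ω
        let τ : ENNReal := LoopErasure.lifetime 1 (fun t ↦ Z t ω)
        let X : NNReal → ℂ := LoopErasure.conditioned 1 (fun t ↦ Z t ω)
        ∀ t₁ t₂ : NNReal,
          (t₁ : ENNReal) ≤ LoopErasure.hitTime X τ σ₁ →
          (t₂ : ENNReal) ≤ LoopErasure.hitTime β' ⊤ σ₂ →
          (t₁, t₂) ∈ LoopErasure.disjointTimes X τ β' ∧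
          X t₁ ∈ LoopErasure.loewnerDomain ξ t₂ ∧
          0 < LoopErasure.ratioM ξ X t₁ t₂ ∧
          |Real.log (LoopErasure.ratioM ξ X t₁ t₂)| ≤ C := by
  obtain ⟨C, hC⟩ := LoopErasure.exists_forall_abs_log_ratioM_le hσ
  refine ⟨C, fun Ω _ P _ Z B β hZ hβ _ ↦ ?_⟩
  filter_upwards [hZ.re.cont, hZ.im.cont, hZ.re.eval_zero_ae_eq_zero, hZ.im.eval_zero_ae_eq_zero,
    hβ.brownian.cont, hβ.curve] with ω hre him hre0 him0 hB hcurve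
  refine hC (fun t ↦ Z t ω) _ _ ?_ (Complex.ext hre0 him0) (hB.const_mul _) hcurve
  have h : Continuous fun t ↦ ((Z t ω).re : ℂ) + (Z t ω).im * Complex.I := by fun_prop
  exact h.congr fun t ↦ Complex.re_add_im _
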